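/- Let $n\ge 1$ and $\mathbb{HP}^n=U(n+1,\mathbb H)/(U(1,\mathbb H)\times U(n,\mathbb H))$, $\chi=8(n+2)$, and let $\langle\mathbf a,\mathbf b\rangle=\mathbf a\bar{\mathbf b}^{\rm t}$ on $\mathbb H^{n-1}$. Write $\mathfrak u(n+1,\mathbb H)=\mathfrak h\oplus\mathfrak m$ for the symmetric decomposition. With matrices in blocks of sizes $1,1,n-1$, let $(m,\mathbf m)\in\mathfrak m$ be the skew-Hermitian matrix with first row $(0,m,\mathbf m)$ and lower right block $0$, and for $u\in\operatorname{Im}\mathbb H$, $\mathbf u\in\mathbb H^{n-1}$ let $$(u,\mathbf u)=\begin{pmatrix}u&0&0\\0&-u&\mathbf u\\0&-\bar{\mathbf u}^{\rm t}&0\end{pmatrix}\in\mathfrak h_\perp .$$ Operators. For scalars $u,v$, vectors $\mathbf u,\mathbf v$ and matrices $\mathbf V\in\mathfrak u(n-1,\mathbb H)$ let $C_uv=uv-vu$, $A_uv=uv+vu$, $C_{\mathbf u}\mathbf v=\frac12(\langle\mathbf u,\mathbf v\rangle-\langle\mathbf v,\mathbf u\rangle)$, $A_{\mathbf u}\mathbf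 v=\frac12(\langle\mathbf u,\mathbf v\rangle+\langle\mathbf v,\mathbf u\rangle)$, $\mathbf C_{\mathbf u}\mathbf v=\bar{\mathbf u}^{\rm t}\mathbf v-\bar{\mathbf v}^{\rm t}\mathbf u$, $R_{\mathbf u}v=v\mathbf u$, $L_u\mathbf v=u\mathbf v$, $L_{\mathbf u}\mathbf V=\mathbf u\mathbf V$, and $$\mathcal H=\begin{pmatrix}D_x-C_uD_x^{-1}C_u & C_{\mathbf u}+C_uD_x^{-1}C_{\mathbf u}\\ R_{\mathbf u}D_x^{-1}C_u+R_{\mathbf u} & D_x-R_{\mathbf u}D_x^{-1}C_{\mathbf u}+L_{\mathbf u}D_x^{-1}\mathbf C_{\mathbf u}-L_u\end{pmatrix},$$ $$\mathcal J=\begin{pmatrix}\frac14D_x-\frac14A_uD_x^{-1}A_u & \frac12C_{\mathbf u}+\frac12A_uD_x^{-1}A_{\mathbf u}\\ \frac12R_{\mathbf u}-\frac12R_{\mathbf u}D_x^{-1}A_u & D_x+L_u+R_{\mathbf u}D_x^{-1}A_{\mathbf u}\end{pmatrix}.$$ Here $D_x^{-1}f$ denotes a solution $p$ of $D_xp=f$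 with $p$ in the same space ($\mathbb R$, $\operatorname{Im}\mathbb H$ or $\mathfrak u(n-1,\mathbb H)$) as $f$; the terms containing $D_x^{-1}$ are collected by linearity, and statements hold for every choice of $p$ unless a particular one is asserted to exist. An inverse operator is the inverse relation. (1) Flow. Let $\gamma(t,x)\in\mathbb{HP}^n$ be a non-stretching curve flow on an open set of the $(t,x)$-plane, with a smooth moving frame $g(t,x)\in U(n+1,\mathbb H)$ over $\gamma$, so that the pulled-back coframe $e$ and connection $\omega$ are the $\mathfrak m$- and $\mathfrak h$-parts of $g^{-1}dg$. Suppose that the frame is parallel: $e_x=\chi^{-1/2}(1,\mathbf 0)$ and $\omega_x=(u,\mathbf u)\in\mathfrak h_\perp$. Let $w=(w^\perp,\mathbf w^\perp)$ be the $\mathfrak h_\perp$-part of $\omega_t$, let $(h_\perp,\mathbf h_\perp)$ be the part of $e_t$ orthogonal to $e_x$, and put $h=\sqrt\chi\,(2h_\perp,-\mathbf h_\perp)$. Then, for suitable choices of $D_x^{-1}$, $$\begin{pmatrix}u_t\\\mathbf u_t\end{pmatrix}=\mathcal H(w)+\chi^{-1}h,\qquad w=\mathcal J(h).$$ (2) Bi-Hamiltonian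 structure. Consider the $x$-jet space of $(u,\mathbf u)$, possibly enlarged by nonlocal variables: a commutative real differential algebra with total derivative $D_x$ and a Lie algebra of prolonged vector fields, i.e. of derivations $X$ commuting with $D_x$. Functionals $\int H\,dx$ are densities modulo total $x$-derivatives, and $\delta\mathfrak F=(-\delta\mathfrak F/\delta u,\ \delta\mathfrak F/\delta\bar{\mathbf u})$ is defined by $X\mathfrak F=\operatorname{Re}\int\langle\delta\mathfrak F,X(u,\mathbf u)\rangle dx$ for all $X$. Let $\mathcal P$ be an operator on scalar-vector pairs. It is *Hamiltonian (cosymplectic)* if the bracket $\{\mathfrak F,\mathfrak G\}=\operatorname{Re}\int\langle\delta\mathfrak F,\mathcal P\,\delta\mathfrak G\rangle dx$ is skew-symmetric and satisfies the Jacobi identity for all functionals that have a variational derivative and a Hamiltonian vector field $X_{\mathfrak F}$, $X_{\mathfrak F}(u,\mathbf u)=\mathcal P\,\delta\mathfrak F$, on the given space, where $\{\mathfrak L,\mathfrak K\}=X_{\mathfrak K}\mathfrak L$ for $\mathfrak L=\{\mathfrak F,\mathfrak G\}$. It is *symplectic* if $\boldsymbol\omega(X_1,X_2)=\operatorname{Re}\int\langle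 X_1(u,\mathbf u),\mathcal P\,X_2(u,\mathbf u)\rangle dx$ is skew-symmetric and closed. On all such spaces, $\mathcal H$ is a Hamiltonian cosymplectic operator, $\mathcal J$ is a symplectic operator, and the two are compatible: for all $c_1,c_2\in\mathbb R$ the operator $c_1\mathcal H+c_2\mathcal J^{-1}$ is Hamiltonian cosymplectic and $c_1\mathcal H^{-1}+c_2\mathcal J$ is symplectic. -/

import Mathlib

open scoped Quaternion ContDiff

universe v

noncomputable section

/-! ## Quaternions over a commutative real algebra

A quaternion-valued differential function is a quaternion whose four real components lie in a
commutative real algebra `A` of real-valued functions. -/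

section Quaternionic

variable (n : ℕ) (A : Type v) [CommRing A] [Algebra ℝ A]

/-- Imaginary quaternions. -/
def imH : Submodule ℝ ℍ[A] where
  carrier := {q | q.re = 0}
  add_mem' := by
    intro a b ha hb
    simp only [Set.mem_ofPred_eq] at ha hb ⊢
    simp [ha, hb]
  zero_mem' := by simp
  smul_mem' := by
    intro c a ha
    simp only [Set.mem_ofPred_eq] at ha ⊢
    simp [ha]

/-- Scalar-vector pairs: an imaginary quaternion together with a quaternionic vector with `n - 1`
components. -/
abbrev QField : Type v := imH A × (Fin (n - 1) → ℍ[A])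

variable {n A}

/-- The imaginary part of a quaternion. -/
def imPart (q : ℍ[A]) : imH A := ⟨⟨0, q.imI, q.imJ, q.imK⟩, rfl⟩

/-- The action of a derivation of `A` on quaternions, componentwise. -/
def dQ (D : Derivation ℝ A A) (q : ℍ[A]) : ℍ[A] := ⟨D q.re, D q.imI, D q.imJ, D q.imK⟩

/-- The action of a derivation of `A` on imaginary quaternions. -/
def dIm (D : Derivation ℝ A A) (q : imH A) : imH A :=
  ⟨dQ D q.1, by
    have h : (q : ℍ[A]).re = 0 := q.2
    change D (q : ℍ[A]).re = 0
    rw [h, map_zero]⟩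

/-- The action of a derivation of `A` on scalar-vector pairs, componentwise. -/
def dField (D : Derivation ℝ A A) (w : QField n A) : QField n A :=
  (dIm D w.1, fun i => dQ D (w.2 i))

/-- The action of a derivation of `A` on quaternionic matrices, entrywise. -/
def dMat {ι : Type*} (D : Derivation ℝ A A) (M : Matrix ι ι ℍ[A]) : Matrix ι ι ℍ[A] :=
  M.map (dQ D)

/-- The Hermitian product `<a, b>`, the sum of the `aᵢ b̄ᵢ`. -/
def herm (a b : Fin (n - 1) → ℍ[A]) : ℍ[A] := ∑ i, a i * star (b i)

/-- The Euclidean pairing `Re (a b̄ + <𝐚, 𝐛>)` of scalar-vector pairs. -/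
def pairing (a b : QField n A) : A :=
  ((a.1 : ℍ[A]) * star (b.1 : ℍ[A]) + herm a.2 b.2).re

/-- The scalar commutator operator `C_u v = u v - v u`. -/
def opC (u v : ℍ[A]) : ℍ[A] := u * v - v * u

/-- The scalar anticommutator operator `A_u v = u v + v u`. -/
def opA (u v : ℍ[A]) : ℍ[A] := u * v + v * u

/-- The vector commutator operator `C_𝐮 𝐯 = ½ (<𝐮, 𝐯> - <𝐯, 𝐮>)`. -/
def opCv (u v : Fin (n - 1) → ℍ[A]) : ℍ[A] := (1 / 2 : ℝ) • (herm u v - herm v u)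

/-- The vector anticommutator operator `A_𝐮 𝐯 = ½ (<𝐮, 𝐯> + <𝐯, 𝐮>)`. -/
def opAv (u v : Fin (n - 1) → ℍ[A]) : ℍ[A] := (1 / 2 : ℝ) • (herm u v + herm v u)

/-- The matrix commutator operator `𝐂_𝐮 𝐯 = 𝐮̄ᵗ 𝐯 - 𝐯̄ᵗ 𝐮`. -/
def opCm (u v : Fin (n - 1) → ℍ[A]) : Matrix (Fin (n - 1)) (Fin (n - 1)) ℍ[A] :=
  fun i j => star (u i) * v j - star (v i) * u j

/-- Right multiplication `R_𝐮 v = v 𝐮` of a scalar by a vector. -/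
def opR (u : Fin (n - 1) → ℍ[A]) (v : ℍ[A]) : Fin (n - 1) → ℍ[A] := fun i => v * u i

/-- Left multiplication `L_u 𝐯 = u 𝐯` of a vector by a scalar. -/
def opL (u : ℍ[A]) (v : Fin (n - 1) → ℍ[A]) : Fin (n - 1) → ℍ[A] := fun i => u * v i

/-- Left multiplication `L_𝐮 𝐕 = 𝐮 𝐕` of a matrix by a row vector. -/
def opLm (u : Fin (n - 1) → ℍ[A]) (V : Matrix (Fin (n - 1)) (Fin (n - 1)) ℍ[A]) :
    Fin (n - 1) → ℍ[A] := Matrix.vecMul u V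

/-- `v = 𝓗 w`, where, with `D = D_x`,

`𝓗 = [ D - C_u D⁻¹ C_u          C_𝐮 + C_u D⁻¹ C_𝐮                    ]`
`    [ R_𝐮 D⁻¹ C_u + R_𝐮        D - R_𝐮 D⁻¹ C_𝐮 + L_𝐮 D⁻¹ 𝐂_𝐮 - L_u ]`.

The formal inverse `D⁻¹ f` stands for a solution `p` of `D p = f` in the space in which `f` lives:
here `p = D⁻¹ (C_u w - C_𝐮 𝐰)` is an imaginary quaternion and `V = D⁻¹ 𝐂_𝐮 𝐰` is a quaternionic
skew-Hermitian matrix. -/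
def hamRel (D : Derivation ℝ A A) (u w v : QField n A) : Prop :=
  ∃ (p : imH A) (V : Matrix (Fin (n - 1)) (Fin (n - 1)) ℍ[A]),
    V.conjTranspose = -V ∧
    dQ D p = opC u.1 w.1 - opCv u.2 w.2 ∧
    dMat D V = opCm u.2 w.2 ∧
    (v.1 : ℍ[A]) = dQ D w.1 - opC u.1 p + opCv u.2 w.2 ∧
    v.2 = opR u.2 p + opR u.2 w.1 + (fun i => dQ D (w.2 i)) + opLm u.2 V - opL u.1 w.2

/-- `w = 𝓙 h`, where, with `D = D_x`,

`𝓙 = [ ¼ D - ¼ A_u D⁻¹ A_u          ½ C_𝐮 + ½ A_u D⁻¹ A_𝐮      ]`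
`    [ ½ R_𝐮 - ½ R_𝐮 D⁻¹ A_u        D + L_u + R_𝐮 D⁻¹ A_𝐮      ]`.

Here `r = D⁻¹ (½ A_u h - A_𝐮 𝐡)` is real. -/
def sympRel (D : Derivation ℝ A A) (u h w : QField n A) : Prop :=
  ∃ r : A,
    ((D r : A) : ℍ[A]) = (1 / 2 : ℝ) • opA u.1 h.1 - opAv u.2 h.2 ∧
    (w.1 : ℍ[A]) = (1 / 4 : ℝ) • dQ D h.1 + (1 / 2 : ℝ) • opCv u.2 h.2
      - (1 / 2 : ℝ) • opA u.1 (r : ℍ[A]) ∧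
    w.2 = (1 / 2 : ℝ) • opR u.2 h.1 + (fun i => dQ D (h.2 i)) + opL u.1 h.2
      - opR u.2 (r : ℍ[A])

end Quaternionic

/-! ## Jet spaces, functionals, and Hamiltonian and symplectic operators -/

/-- The differential algebra of real-valued functions on the `x`-jet space of the scalar-vector
variable `u`, possibly enlarged by nonlocal variables. It carries the total derivative `D`, the
variable `u` (the jet coordinates are the `D^k u`), and a Lie algebra `vf` of prolonged evolutionary
vector fields: derivations that commute with `D`. The vector field `X` is the prolongation of
`X u · ∂/∂u`.

On the local jet space itself `vf` consists of the prolongations of all evolutionary vector fields.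
Since `D⁻¹` of a local function is in general not a function on the local jet space, such nonlocal
functions are adjoined to the algebra as further elements, to which the vector fields extend. -/
structure JetAlgebra (n : ℕ) where
  /-- The algebra of (differential or nonlocal) functions. -/
  carrier : Type v
  [ring : CommRing carrier]
  [alg : Algebra ℝ carrier]
  /-- The total `x`-derivative. -/
  D : Derivation ℝ carrier carrier
  /-- The field variable. -/
  u : QField n carrier
  /-- The prolonged evolutionary vector fields. -/
  vf : LieSubalgebra ℝ (Derivation ℝ carrier carrier)
  /-- Prolonged vector fields commute with the total derivative. -/
  vf_comm : ∀ X ∈ vf, ∀ a, X (D a) = D (X a)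

attribute [instance] JetAlgebra.ring JetAlgebra.alg

/-- Real coordinates of a scalar-vector pair: three for the imaginary scalar, four for each
component of the vector. -/
abbrev Coord (n : ℕ) : Type := Fin 3 ⊕ (Fin (n - 1) × Fin 4)

/-- Differential polynomials: polynomials in `x` (the variable `none`) and in the jet coordinates
`D^k u^c` (the variables `some (k, c)`). -/
abbrev DiffPoly (n : ℕ) : Type := MvPolynomial (Option (ℕ × Coord n)) ℝ

/-- The total derivative of differential polynomials. -/
def totalD (n : ℕ) : Derivation ℝ (DiffPoly n) (DiffPoly n) :=
  MvPolynomial.mkDerivation ℝ fun v => match v with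
    | none => 1
    | some (k, c) => MvPolynomial.X (some (k + 1, c))

/-- The basic example: the local jet space `(x, u, u_x, u_xx, …)` with polynomial functions and all
prolonged evolutionary vector fields. -/
def localJets (n : ℕ) : JetAlgebra.{0} n where
  carrier := DiffPoly n
  D := totalD n
  u :=
    (⟨⟨0, MvPolynomial.X (some (0, Sum.inl 0)), MvPolynomial.X (some (0, Sum.inl 1)),
        MvPolynomial.X (some (0, Sum.inl 2))⟩, rfl⟩,
      fun i => ⟨MvPolynomial.X (some (0, Sum.inr (i, 0))), MvPolynomial.X (some (0, Sum.inr (i, 1))),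
        MvPolynomial.X (some (0, Sum.inr (i, 2))), MvPolynomial.X (some (0, Sum.inr (i, 3)))⟩)
  vf :=
    { carrier := {X | X (MvPolynomial.X none) = 0 ∧ ∀ a, X (totalD n a) = totalD n (X a)}
      zero_mem' := by simp
      add_mem' := by
        intro X Y hX hY
        simp only [Set.mem_ofPred_eq] at hX hY ⊢
        exact ⟨by simp [hX.1, hY.1], fun a => by simp [hX.2, hY.2]⟩
      smul_mem' := by
        intro c X hX
        simp only [Set.mem_ofPred_eq] at hX ⊢
        exact ⟨by simp [hX.1], fun a => by simp [hX.2]⟩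
      lie_mem' := by
        intro X Y hX hY
        refine ⟨?_, fun a => ?_⟩
        · rw [Derivation.commutator_apply, hX.1, hY.1, map_zero, map_zero, sub_zero]
        · rw [Derivation.commutator_apply, Derivation.commutator_apply, hX.2, hY.2, hX.2, hY.2,
            map_sub] }
  vf_comm := fun _ hX => hX.2

namespace JetAlgebra

variable {n : ℕ} (J : JetAlgebra.{v} n)

/-- Scalar-vector pairs of functions on the jet space. -/
abbrev Field : Type v := QField n J.carrier

/-- Functionals `∫ H dx`: densities modulo total `x`-derivatives. -/
abbrev Functional : Type v := J.carrier ⧸ LinearMap.range J.D.toLinearMap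

/-- The functional `∫ H dx` with density `H`. -/
def integral (H : J.carrier) : J.Functional := Submodule.Quotient.mk H

/-- The components `X u` of a vector field `X`. -/
def comps (X : J.vf) : J.Field := dField X.1 J.u

/-- The variation of a functional under a vector field: `∫ H dx ↦ ∫ X H dx`. -/
def act (X : J.vf) : J.Functional →ₗ[ℝ] J.Functional :=
  Submodule.mapQ _ _ X.1.toLinearMap (by
    rintro _ ⟨a, rfl⟩
    exact ⟨X.1 a, (J.vf_comm X.1 X.2 a).symm⟩)

/-- `w` is the variational derivative of the functional `F`, as a gradient for the Euclidean
pairing: `w = (-δF/δu, δF/δ𝐮̄)`. -/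
def IsVarDeriv (F : J.Functional) (w : J.Field) : Prop :=
  ∀ X : J.vf, J.act X F = J.integral (pairing w (J.comps X))

end JetAlgebra

/-- Nonlocal operators on scalar-vector pairs of functions on the jet space, given through their
graphs: `P J w v` means `v = P w`. -/
def NonlocalOp (n : ℕ) : Type (v + 1) := ∀ J : JetAlgebra.{v} n, J.Field → J.Field → Prop

namespace NonlocalOp

variable {n : ℕ}

/-- The formal inverse operator. -/
def inverse (P : NonlocalOp.{v} n) : NonlocalOp.{v} n := fun J w v => P J v w

/-- The linear combination `c₁ P + c₂ Q`. -/
def comb (c₁ c₂ : ℝ) (P Q : NonlocalOp.{v} n) : NonlocalOp.{v} n := fun J w v =>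
  ∃ v₁ v₂ : J.Field, P J w v₁ ∧ Q J w v₂ ∧ v = c₁ • v₁ + c₂ • v₂

/-- A functional `𝔉` with its variational derivative `δ𝔉` and its Hamiltonian vector field, the
prolonged vector field with components `P δ𝔉`. -/
structure HamFunctional (P : NonlocalOp.{v} n) (J : JetAlgebra.{v} n) where
  /-- The functional. -/
  val : J.Functional
  /-- Its variational derivative. -/
  grad : J.Field
  isVarDeriv : J.IsVarDeriv val grad
  /-- Its Hamiltonian vector field. -/
  vec : J.vf
  vec_eq : P J grad (J.comps vec)

/-- The Poisson bracket `{𝔉, 𝔊} = Re ∫ <δ𝔉, P δ𝔊> dx`. -/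
def poisson {P : NonlocalOp.{v} n} {J : JetAlgebra.{v} n} (F G : HamFunctional P J) :
    J.Functional :=
  J.integral (pairing F.grad (J.comps G.vec))

/-- `P` is a Hamiltonian cosymplectic operator: its Poisson bracket is skew-symmetric and satisfies
the Jacobi identity. The bracket `{𝔏, 𝔎} = Re ∫ <δ𝔏, P δ𝔎> dx` of `𝔏 = {𝔉, 𝔊}` with `𝔎` is the
variation of `𝔏` under the Hamiltonian vector field of `𝔎`. -/
def IsHamiltonian (P : NonlocalOp.{v} n) : Prop :=
  ∀ J : JetAlgebra.{v} n,
    (∀ F G : HamFunctional P J, poisson F G = -poisson G F) ∧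
    (∀ F G K : HamFunctional P J,
      J.act K.vec (poisson F G) + J.act F.vec (poisson G K) + J.act G.vec (poisson K F) = 0)

/-- `P` is a symplectic operator: the two-form `ω(X₁, X₂) = Re ∫ <X₁ u, P (X₂ u)> dx` is
skew-symmetric and closed, `X₁ ω(X₂, X₃) - ω([X₁, X₂], X₃) + cyclic = 0`. -/
def IsSymplectic (P : NonlocalOp.{v} n) : Prop :=
  ∀ J : JetAlgebra.{v} n,
    (∀ (X₁ X₂ : J.vf) (v₁ v₂ : J.Field), P J (J.comps X₁) v₁ → P J (J.comps X₂) v₂ →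
      J.integral (pairing (J.comps X₁) v₂) = -J.integral (pairing (J.comps X₂) v₁)) ∧
    (∀ (X₁ X₂ X₃ : J.vf) (v₁ v₂ v₃ : J.Field),
      P J (J.comps X₁) v₁ → P J (J.comps X₂) v₂ → P J (J.comps X₃) v₃ →
      (J.act X₁ (J.integral (pairing (J.comps X₂) v₃))
          - J.integral (pairing (J.comps ⁅X₁, X₂⁆) v₃))
        + (J.act X₂ (J.integral (pairing (J.comps X₃) v₁))
          - J.integral (pairing (J.comps ⁅X₂, X₃⁆) v₁))
        + (J.act X₃ (J.integral (pairing (J.comps X₁) v₂))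
          - J.integral (pairing (J.comps ⁅X₃, X₁⁆) v₂)) = 0)

/-- Compatibility of a cosymplectic operator `H` and a symplectic operator `S`: all linear
combinations `c₁ H + c₂ S⁻¹` are Hamiltonian cosymplectic operators, and all linear combinations
`c₁ H⁻¹ + c₂ S` are symplectic operators. -/
def Compatible (H S : NonlocalOp.{v} n) : Prop :=
  (∀ c₁ c₂ : ℝ, IsHamiltonian (comb c₁ c₂ H S.inverse)) ∧
  (∀ c₁ c₂ : ℝ, IsSymplectic (comb c₁ c₂ H.inverse S))

end NonlocalOp

/-- The operator `𝓗` on jet spaces. -/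
def opH (n : ℕ) : NonlocalOp.{v} n := fun J w v => hamRel J.D J.u w v

/-- The operator `𝓙` on jet spaces. -/
def opJ (n : ℕ) : NonlocalOp.{v} n := fun J h w => sympRel J.D J.u h w

/-! ## Smooth functions of `(t, x)` -/

/-- Smooth real functions on an open set of the `(t, x)`-plane. -/
def SmoothFn (U : TopologicalSpace.Opens (ℝ × ℝ)) : Subalgebra ℝ (U → ℝ) where
  carrier := {f | ContDiffOn ℝ ∞ (Function.extend Subtype.val f (0 : ℝ × ℝ → ℝ)) (U : Set (ℝ × ℝ))}
  mul_mem' := by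
    intro f g hf hg
    refine (ContDiffOn.mul hf hg).congr fun p hp => ?_
    have h : ∀ k : U → ℝ, Function.extend Subtype.val k (0 : ℝ × ℝ → ℝ) p = k ⟨p, hp⟩ := fun k =>
      Subtype.val_injective.extend_apply k 0 ⟨p, hp⟩
    simp [h]
  add_mem' := by
    intro f g hf hg
    refine (ContDiffOn.add hf hg).congr fun p hp => ?_
    have h : ∀ k : U → ℝ, Function.extend Subtype.val k (0 : ℝ × ℝ → ℝ) p = k ⟨p, hp⟩ := fun k =>
      Subtype.val_injective.extend_apply k 0 ⟨p, hp⟩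
    simp [h]
  algebraMap_mem' := by
    intro c
    refine (contDiffOn_const (c := c)).congr fun p hp => ?_
    have h : ∀ k : U → ℝ, Function.extend Subtype.val k (0 : ℝ × ℝ → ℝ) p = k ⟨p, hp⟩ := fun k =>
      Subtype.val_injective.extend_apply k 0 ⟨p, hp⟩
    simp [h]

namespace SmoothFn

variable {U : TopologicalSpace.Opens (ℝ × ℝ)}

/-- The extension by zero to the whole plane. -/
def ext (f : SmoothFn U) : ℝ × ℝ → ℝ := Function.extend Subtype.val f.1 0

theorem ext_apply (f : SmoothFn U) (p : U) : ext f p = f.1 p :=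
  Subtype.val_injective.extend_apply f.1 0 p

theorem differentiableAt_ext (f : SmoothFn U) (p : U) : DifferentiableAt ℝ (ext f) p := by
  have h : ContDiffOn ℝ ∞ (ext f) (U : Set (ℝ × ℝ)) := f.2
  exact (h.contDiffAt (U.isOpen.mem_nhds p.2)).differentiableAt (by simp)

theorem eventuallyEq_ext {f : SmoothFn U} {g : ℝ × ℝ → ℝ} (h : ∀ q : U, f.1 q = g q) (p : U) :
    ext f =ᶠ[nhds (p : ℝ × ℝ)] g := by
  filter_upwards [U.isOpen.mem_nhds p.2] with q hq
  rw [← h ⟨q, hq⟩]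
  exact ext_apply f ⟨q, hq⟩

/-- The derivative of a smooth function in the constant direction `e`. -/
def dir (e : ℝ × ℝ) (f : SmoothFn U) : SmoothFn U :=
  ⟨fun p => fderiv ℝ (ext f) p e, by
    have h : ContDiffOn ℝ ∞ (ext f) (U : Set (ℝ × ℝ)) := f.2
    have h' := ((contDiffOn_infty_iff_fderiv_of_isOpen U.isOpen).1 h).2
    have h'' : ContDiffOn ℝ ∞ (fun p => fderiv ℝ (ext f) p e) (U : Set (ℝ × ℝ)) :=
      h'.clm_apply contDiffOn_const
    refine h''.congr fun p hp => ?_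
    exact Subtype.val_injective.extend_apply (fun p : U => fderiv ℝ (ext f) p e)
      (0 : ℝ × ℝ → ℝ) (⟨p, hp⟩ : U)⟩

/-- The derivative in the constant direction `e`, as a derivation. -/
def deriv (e : ℝ × ℝ) : Derivation ℝ (SmoothFn U) (SmoothFn U) :=
  Derivation.mk'
    { toFun := dir e
      map_add' := by
        intro f g
        apply Subtype.ext
        funext p
        have h := (eventuallyEq_ext (f := f + g) (g := ext f + ext g)
          (fun q => by simp [ext_apply]) p).fderiv_eq (𝕜 := ℝ)
        change fderiv ℝ (ext (f + g)) p e = fderiv ℝ (ext f) p e + fderiv ℝ (ext g) p e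
        rw [h, fderiv_add (differentiableAt_ext f p) (differentiableAt_ext g p)]
        rfl
      map_smul' := by
        intro c f
        apply Subtype.ext
        funext p
        have h := (eventuallyEq_ext (f := c • f) (g := c • ext f)
          (fun q => by simp [ext_apply]) p).fderiv_eq (𝕜 := ℝ)
        change fderiv ℝ (ext (c • f)) p e = c • fderiv ℝ (ext f) p e
        rw [h, fderiv_const_smul (differentiableAt_ext f p)]
        rfl }
    (by
      intro f g
      apply Subtype.ext
      funext p
      have h := (eventuallyEq_ext (f := f * g) (g := ext f * ext g)
        (fun q => by simp [ext_apply]) p).fderiv_eq (𝕜 := ℝ)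
      change fderiv ℝ (ext (f * g)) p e
        = f.1 p * fderiv ℝ (ext g) p e + g.1 p * fderiv ℝ (ext f) p e
      rw [h, fderiv_mul (differentiableAt_ext f p) (differentiableAt_ext g p)]
      simp [ext_apply])

variable (U)

/-- The derivation `∂/∂t`. -/
def dt : Derivation ℝ (SmoothFn U) (SmoothFn U) := deriv (1, 0)

/-- The derivation `∂/∂x`. -/
def dx : Derivation ℝ (SmoothFn U) (SmoothFn U) := deriv (0, 1)

variable {U}

/-- The value at a point of a quaternion-valued smooth function. -/
def evalQ (p : U) (q : ℍ[SmoothFn U]) : ℍ[ℝ] := ⟨q.re.1 p, q.imI.1 p, q.imJ.1 p, q.imK.1 p⟩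

end SmoothFn

/-! ## Quaternionic projective space and parallel moving frames -/

section Geometry

/-- Index set of `(n + 1) × (n + 1)` matrices in blocks of sizes `1`, `1`, `n - 1`. -/
abbrev Idx (n : ℕ) : Type := Unit ⊕ (Unit ⊕ Fin (n - 1))

variable (n : ℕ)

/-- The quaternion unitary group `U(n + 1, ℍ) ≃ Sp(n + 1)`. -/
abbrev UH : Type := unitary (Matrix (Idx n) (Idx n) ℍ[ℝ])

/-- The isotropy group `U(1, ℍ) × U(n, ℍ)` of block diagonal elements of `U(n + 1, ℍ)`. -/
def isotropy : Subgroup (UH n) where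
  carrier := {g | ∀ j, g.1 (Sum.inl ()) (Sum.inr j) = 0 ∧ g.1 (Sum.inr j) (Sum.inl ()) = 0}
  one_mem' := by
    intro j
    simp
  mul_mem' := by
    intro a b ha hb j
    simp only [Set.mem_ofPred_eq] at ha hb
    constructor
    · simp [Matrix.mul_apply, Fintype.sum_sum_type, (ha _).1, (hb _).1]
    · simp [Matrix.mul_apply, Fintype.sum_sum_type, (ha _).2, (hb _).2]
  inv_mem' := by
    intro a ha j
    have h : (a⁻¹ : UH n).1 = star a.1 := rfl
    rw [h]
    constructor
    · simp [Matrix.star_apply, (ha j).2]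
    · simp [Matrix.star_apply, (ha j).1]

/-- Quaternionic projective space `ℍPⁿ = U(n + 1, ℍ) / (U(1, ℍ) × U(n, ℍ))`. -/
abbrev HP : Type := UH n ⧸ isotropy n

variable {n} {A : Type v} [CommRing A] [Algebra ℝ A]

/-- The element `(m, 𝐦)` of the space `𝔪` of the symmetric decomposition `𝔲(n+1, ℍ) = 𝔥 ⊕ 𝔪`. -/
def mMat (m : ℍ[A]) (mv : Fin (n - 1) → ℍ[A]) : Matrix (Idx n) (Idx n) ℍ[A]
  | Sum.inl _, Sum.inr (Sum.inl _) => m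
  | Sum.inl _, Sum.inr (Sum.inr j) => mv j
  | Sum.inr (Sum.inl _), Sum.inl _ => -star m
  | Sum.inr (Sum.inr i), Sum.inl _ => -star (mv i)
  | _, _ => 0

/-- The element `(h, 𝐡)` of `𝔥_⊥`: diagonal blocks `h`, `-h`, `0`, off-diagonal blocks `𝐡`, `-𝐡̄ᵗ`. -/
def hPerpMat (w : QField n A) : Matrix (Idx n) (Idx n) ℍ[A]
  | Sum.inl _, Sum.inl _ => w.1
  | Sum.inr (Sum.inl _), Sum.inr (Sum.inl _) => -w.1
  | Sum.inr (Sum.inl _), Sum.inr (Sum.inr j) => w.2 j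
  | Sum.inr (Sum.inr i), Sum.inr (Sum.inl _) => -star (w.2 i)
  | _, _ => 0

/-- The component in `𝔪_⊥` of a matrix in `𝔲(n + 1, ℍ)`, as a scalar-vector pair. -/
def mPerp (M : Matrix (Idx n) (Idx n) ℍ[A]) : QField n A :=
  (imPart (M (Sum.inl ()) (Sum.inr (Sum.inl ()))),
    fun j => M (Sum.inl ()) (Sum.inr (Sum.inr j)))

/-- The component in `𝔥_⊥` of a matrix in `𝔲(n + 1, ℍ)`, as a scalar-vector pair. -/
def hPerp (M : Matrix (Idx n) (Idx n) ℍ[A]) : QField n A :=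
  (imPart ((1 / 2 : ℝ) • (M (Sum.inl ()) (Sum.inl ())
      - M (Sum.inr (Sum.inl ())) (Sum.inr (Sum.inl ())))),
    fun j => M (Sum.inr (Sum.inl ())) (Sum.inr (Sum.inr j)))

/-- The normalization constant `χ = 8 (n + 2)` of the Cartan-Killing form on `𝔪`:
`⟨(m, 𝐦), (m, 𝐦)⟩ = -χ (|m|² + |𝐦|²)`. -/
def chi (n : ℕ) : ℝ := 8 * ((n : ℝ) + 2)

variable {U : TopologicalSpace.Opens (ℝ × ℝ)}

/-- A smooth moving frame along a map `γ` of the `(t, x)`-plane into `ℍPⁿ`: a smooth lift of `γ`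
to `U(n + 1, ℍ)`. The pullbacks of the `𝔪`-valued linear coframe `e` and of the `𝔥`-valued linear
connection `ω` by such a frame are the components of the left Maurer-Cartan form `g⁻¹ dg = e + ω`. -/
structure MovingFrame (γ : U → HP n) where
  /-- The matrix of smooth quaternion-valued functions. -/
  mat : Matrix (Idx n) (Idx n) ℍ[SmoothFn U]
  /-- Its values. -/
  lift : U → UH n
  lift_eq : ∀ p i j, (lift p).1 i j = SmoothFn.evalQ p (mat i j)
  proj : ∀ p, (QuotientGroup.mk (lift p) : HP n) = γ p

namespace MovingFrame

variable {γ : U → HP n} (g : MovingFrame γ)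

/-- `e_t + ω_t = g⁻¹ g_t`. -/
def formT : Matrix (Idx n) (Idx n) ℍ[SmoothFn U] :=
  g.mat.conjTranspose * dMat (SmoothFn.dt U) g.mat

/-- `e_x + ω_x = g⁻¹ g_x`. -/
def formX : Matrix (Idx n) (Idx n) ℍ[SmoothFn U] :=
  g.mat.conjTranspose * dMat (SmoothFn.dx U) g.mat

/-- The variable `(u, 𝐮)`: the component of `ω_x` in `𝔥_⊥`. -/
def u : QField n (SmoothFn U) := hPerp g.formX

/-- The frame is `U(1, ℍ) × U(n, ℍ)`-parallel: `e_x = χ^{-1/2} (1, 𝟎)` and `ω_x = (u, 𝐮) ∈ 𝔥_⊥`.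
In particular `-⟨e_x, e_x⟩ = |γ_x|² = 1`: the flow is non-stretching and `x` is the arclength. -/
def IsParallel : Prop :=
  g.formX = (Real.sqrt (chi n))⁻¹ • mMat (1 : ℍ[SmoothFn U]) 0 + hPerpMat g.u

/-- The variable `(w^⊥, 𝐰^⊥)`: the component of `ω_t` in `𝔥_⊥`. -/
def w : QField n (SmoothFn U) := hPerp g.formT

/-- The variable `(h^⊥, 𝐡^⊥) = √χ (2 h_⊥, -𝐡_⊥)`, where `(h_⊥, 𝐡_⊥)` is the component of `e_t` in
`𝔪_⊥`. This is `χ ad(e_x) (h_⊥, 𝐡_⊥)`. -/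
def h : QField n (SmoothFn U) :=
  (Real.sqrt (chi n) • (2 : ℝ) • (mPerp g.formT).1, -(Real.sqrt (chi n) • (mPerp g.formT).2))

/-- The flow of `(u, 𝐮)` has the operator form `u_t = 𝓗(w) + χ⁻¹ h`, `w = 𝓙(h)`. -/
def OperatorForm : Prop :=
  ∃ v : QField n (SmoothFn U),
    hamRel (SmoothFn.dx U) g.u g.w v ∧
    dField (SmoothFn.dt U) g.u = v + (chi n)⁻¹ • g.h ∧
    sympRel (SmoothFn.dx U) g.u g.h g.w

end MovingFrame

end Geometry

end

/-! Everything takes place in the skew-Hermitian matrices, split as `𝔥 ⊕ 𝔪`. Put `Q = (u, 𝐮) ∈ 𝔥_⊥`,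
`∇ = D_x + ad Q` and let `e = (1, 𝟎) ∈ 𝔪`.

Both operators become local relations once the nonlocal variables are absorbed into matrices. `v = 𝓗
w` yields `Ω ∈ 𝔥` with `𝔥_⊥`-part `w` and `∇Ω = v`; the unknowns `p` and `V` are its entries in the
centralizer of `e`. `w = 𝓙 h` yields `μ ∈ 𝔪` with `[e, μ] = h` and `∇μ = -[e, w]`; the unknown `r`
is its entry along `e`. These extra entries are seen neither by `ad e` nor by the trace pairing with
`𝔥_⊥`, which is why the choice of `D_x⁻¹` is immaterial.

Hence one statement covers all the Hamiltonian claims. Let `y = a ∇Ω + b [e, μ]` and `∇μ = -[e, Ω]`.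
The two-form sending a pair of tangent vectors to `∫ Re tr (y₁ Ω₂)` is skew and closed
(`liePoisson_skew`, `liePoisson_closed`). Only these facts enter: `∇` and `ad e` are derivations
annihilated by the trace functional, a vector field `X` commutes with `ad e`, and `[X, ∇] = ad (X
Q)`. The variation of the form then reduces to the invariant form `tr (x [y, z])`, and the remaining
terms cancel by the Leibniz rule. The values `(a, b) = (1, 0)`, `(0, 1)`, `(c₁, c₂)` give `𝓗⁻¹`, `𝓙`
and `(c₁ 𝓗 + c₂ 𝓙⁻¹)⁻¹`. A symplectic inverse makes an operator Hamiltonian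
(`isHamiltonian_of_inverse`), and being symplectic is a linear condition, which settles `c₁ 𝓗⁻¹ + c₂
𝓙`.

The flow is the Maurer-Cartan equation `∂_t ω_x = ∂_x ω_t + [ω_x, ω_t]` of the frame (here `ω`
includes the coframe): its `𝔥`-part is `u_t = 𝓗 w + χ⁻¹ h`, its `𝔪`-part is `w = 𝓙 h`
(`parallel_operatorForm`). -/

set_option linter.unusedSectionVars false

/-! ## Closed two-forms of Lie-Poisson type -/

section LiePoisson

variable {R F : Type*} [Ring R] [Algebra ℝ R] [AddCommGroup F] [Module ℝ F]

/-- A linear endomorphism of a noncommutative algebra that satisfies the Leibniz rule. -/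
def IsLeibniz (D : R →ₗ[ℝ] R) : Prop := ∀ x y, D (x * y) = D x * y + x * D y

/-- The inner derivation `ad q`. -/
def innerDer (q : R) : R →ₗ[ℝ] R := LinearMap.mulLeft ℝ q - LinearMap.mulRight ℝ q

theorem innerDer_apply (q x : R) : innerDer q x = q * x - x * q := rfl

theorem isLeibniz_innerDer (q : R) : IsLeibniz (innerDer q) := by
  intro x y
  simp only [innerDer_apply]
  noncomm_ring

theorem IsLeibniz.add {D E : R →ₗ[ℝ] R} (hD : IsLeibniz D) (hE : IsLeibniz E) :
    IsLeibniz (D + E) := by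
  intro x y
  simp only [LinearMap.add_apply, hD x y, hE x y]
  noncomm_ring

variable {τ : R →ₗ[ℝ] F}

theorem trace_innerDer (hτ : ∀ x y, τ (x * y) = τ (y * x)) (q x : R) : τ (innerDer q x) = 0 := by
  rw [innerDer_apply, map_sub, hτ, sub_self]

theorem trace_by_parts {D : R →ₗ[ℝ] R} (hD : IsLeibniz D) (h0 : ∀ x, τ (D x) = 0) (x y : R) :
    τ (D x * y) = -τ (x * D y) := by
  have h := h0 (x * y)
  rw [hD, map_add] at h
  exact eq_neg_of_add_eq_zero_left h

variable (τ) in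
/-- The trilinear form `τ (x [y, z])`. -/
def triForm (x y z : R) : F := τ (x * (y * z - z * y))

theorem triForm_rotate (hτ : ∀ x y, τ (x * y) = τ (y * x)) (x y z : R) :
    triForm τ x y z = triForm τ y z x := by
  have h1 := hτ x (y * z)
  have h2 := hτ (x * z) y
  simp only [triForm, mul_sub, map_sub, ← mul_assoc] at h1 h2 ⊢
  rw [h1, h2]

theorem triForm_neg_left (x y z : R) : triForm τ (-x) y z = -triForm τ x y z := by
  simp [triForm]

/-- A derivation `D` also respects commutators, so the sum is `τ` of the total derivative `D (x [y,
z])`, which vanishes. -/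
theorem triForm_leibniz {D : R →ₗ[ℝ] R} (hD : IsLeibniz D) (h0 : ∀ x, τ (D x) = 0) (x y z : R) :
    triForm τ (D x) y z + triForm τ x (D y) z + triForm τ x y (D z) = 0 := by
  have h := h0 (x * (y * z - z * y))
  simp only [triForm, ← map_add]
  rw [← h, hD, map_sub, hD, hD]
  congr 1
  noncomm_ring

/-- `triForm_leibniz` with all derivatives rotated to the first place. -/
theorem triForm_leibniz_rotate (hτ : ∀ x y, τ (x * y) = τ (y * x)) {D : R →ₗ[ℝ] R}
    (hD : IsLeibniz D) (h0 : ∀ x, τ (D x) = 0) (x y z : R) :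
    triForm τ (D x) y z + triForm τ (D y) z x + triForm τ (D z) x y = 0 := by
  have h := triForm_leibniz hD h0 x y z
  rwa [triForm_rotate hτ x (D y) z, triForm_rotate hτ x y (D z), triForm_rotate hτ y (D z) x] at h

theorem triForm_add_smul (a b : ℝ) (x x' y z : R) :
    triForm τ (a • x + b • x') y z = a • triForm τ x y z + b • triForm τ x' y z := by
  simp [triForm, add_mul]

/-- Skew-symmetry of the two-form of Lie-Poisson type. -/
theorem liePoisson_skew (hτ : ∀ x y, τ (x * y) = τ (y * x)) {N E : R →ₗ[ℝ] R}
    (hN : IsLeibniz N) (hE : IsLeibniz E) (hN0 : ∀ x, τ (N x) = 0) (hE0 : ∀ x, τ (E x) = 0)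
    (a b : ℝ) {q₁ q₂ w₁ w₂ m₁ m₂ : R}
    (h₁ : q₁ = a • N w₁ + b • E m₁) (h₂ : q₂ = a • N w₂ + b • E m₂)
    (k₁ : N m₁ = -E w₁) (k₂ : N m₂ = -E w₂) :
    τ (q₁ * w₂) = -τ (q₂ * w₁) := by
  -- Moving `E` off `m` and trading `E w'` for `-N m'` turns the mixed term into one built from `N`
  -- alone, where skewness is integration by parts.
  have key : ∀ w m w' m' : R, N m' = -E w' →
      τ ((a • N w + b • E m) * w') = a • τ (N w * w') + b • τ (m * N m') := by
    intro w m w' m' k'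
    rw [add_mul, map_add, smul_mul_assoc, smul_mul_assoc, map_smul, map_smul,
      trace_by_parts hE hE0 m w', k', mul_neg, map_neg]
  rw [h₁, h₂, key _ _ _ _ k₂, key _ _ _ _ k₁, trace_by_parts hN hN0 w₁ w₂, hτ w₁,
    ← neg_eq_iff_eq_neg.2 (trace_by_parts hN hN0 m₁ m₂), hτ (N m₁)]
  module

/-- Second variation of the two-form of Lie-Poisson type. -/
theorem liePoisson_second_variation (hτ : ∀ x y, τ (x * y) = τ (y * x)) {N E X : R →ₗ[ℝ] R}
    (hN : IsLeibniz N) (hE : IsLeibniz E) (hN0 : ∀ x, τ (N x) = 0) (hE0 : ∀ x, τ (E x) = 0)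
    (a b : ℝ) {q : R} (hXN : ∀ x, X (N x) = N (X x) + innerDer q x)
    (hXE : ∀ x, X (E x) = E (X x)) {q₁ q₃ w₁ w₃ m₁ m₃ : R}
    (h₁ : q₁ = a • N w₁ + b • E m₁) (h₃ : q₃ = a • N w₃ + b • E m₃)
    (k₁ : N m₁ = -E w₁) (k₃ : N m₃ = -E w₃) :
    τ (X q₁ * w₃) = a • triForm τ q w₁ w₃ + b • triForm τ q m₁ m₃ - τ (q₃ * X w₁) := by
  have hinv : ∀ x y, τ (innerDer q x * y) = triForm τ q x y := by
    intro x y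
    have h := hτ (x * q) y
    have h' := hτ y (x * q)
    have h'' := hτ (q * y) x
    simp only [innerDer_apply, triForm, sub_mul, mul_sub, map_sub, ← mul_assoc] at h h' h'' ⊢
    rw [h'', ← h'', hτ (q * y) x, ← mul_assoc]
  -- The constraint is differentiated along `X`; the commutator `[X, N] = ad q` leaves the source
  -- term that produces `triForm τ q m₁ m₃`.
  have k₁' : N (X m₁) = -(innerDer q m₁) - E (X w₁) := by
    have h := congrArg X k₁
    rw [hXN, map_neg, hXE] at h
    rw [eq_sub_of_add_eq h]
    abel
  have hA : τ (N (X w₁) * w₃) = -τ (N w₃ * X w₁) := by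
    rw [trace_by_parts hN hN0, hτ]
  have hB : τ (E (X m₁) * w₃) = triForm τ q m₁ m₃ - τ (E m₃ * X w₁) := by
    have e1 : τ (X m₁ * N m₃) = -τ (N (X m₁) * m₃) := by
      rw [trace_by_parts hN hN0, neg_neg]
    have e2 := trace_by_parts hE hE0 (X w₁) m₃
    rw [trace_by_parts hE hE0, ← neg_eq_iff_eq_neg.2 k₃, mul_neg, map_neg, neg_neg, e1, k₁',
      sub_mul, neg_mul, map_sub, map_neg, hinv, e2, hτ (E m₃)]
    abel
  rw [h₁, h₃, map_add, map_smul, map_smul, hXN, hXE]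
  simp only [add_mul, smul_mul_assoc, map_add, map_smul, smul_add, hA, hB, hinv]
  module

/-- Closedness of the two-form of Lie-Poisson type. -/
theorem liePoisson_closed (hτ : ∀ x y, τ (x * y) = τ (y * x)) {N E : R →ₗ[ℝ] R}
    (hN : IsLeibniz N) (hE : IsLeibniz E) (hN0 : ∀ x, τ (N x) = 0) (hE0 : ∀ x, τ (E x) = 0)
    (a b : ℝ) {X₁ X₂ X₃ : R →ₗ[ℝ] R} {q₁ q₂ q₃ w₁ w₂ w₃ m₁ m₂ m₃ : R}
    (hN₁ : ∀ x, X₁ (N x) = N (X₁ x) + innerDer q₁ x)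
    (hN₂ : ∀ x, X₂ (N x) = N (X₂ x) + innerDer q₂ x)
    (hN₃ : ∀ x, X₃ (N x) = N (X₃ x) + innerDer q₃ x)
    (hE₁ : ∀ x, X₁ (E x) = E (X₁ x)) (hE₂ : ∀ x, X₂ (E x) = E (X₂ x))
    (hE₃ : ∀ x, X₃ (E x) = E (X₃ x))
    (h₁ : q₁ = a • N w₁ + b • E m₁) (h₂ : q₂ = a • N w₂ + b • E m₂)
    (h₃ : q₃ = a • N w₃ + b • E m₃)
    (k₁ : N m₁ = -E w₁) (k₂ : N m₂ = -E w₂) (k₃ : N m₃ = -E w₃) :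
    (τ (X₂ q₁ * w₃) + τ (q₂ * X₁ w₃)) + (τ (X₃ q₂ * w₁) + τ (q₃ * X₂ w₁))
      + (τ (X₁ q₃ * w₂) + τ (q₁ * X₃ w₂)) = 0 := by
  -- Each term `-τ (q₃ * X w₁)` is the negative of one already in the cyclic sum, so only trilinear
  -- forms remain.
  rw [liePoisson_second_variation hτ hN hE hN0 hE0 a b hN₂ hE₂ h₁ h₃ k₁ k₃,
    liePoisson_second_variation hτ hN hE hN0 hE0 a b hN₃ hE₃ h₂ h₁ k₂ k₁,
    liePoisson_second_variation hτ hN hE hN0 hE0 a b hN₁ hE₁ h₃ h₂ k₃ k₂]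
  have aa := triForm_leibniz_rotate hτ hN hN0 w₂ w₁ w₃
  have bb := triForm_leibniz_rotate hτ hE hE0 m₂ m₁ m₃
  -- Invariance under `N` moves it from `x` to `y'` and `z'`, where the constraint replaces it by
  -- `E`; all `a b` terms then fall under invariance under `E`.
  have mixed : ∀ x y z y' z' : R, N y' = -E y → N z' = -E z →
      triForm τ (N x) y' z' = triForm τ (E y) z' x + triForm τ (E z) x y' := by
    intro x y z y' z' hy hz
    have h := triForm_leibniz_rotate hτ hN hN0 x y' z'
    rw [hy, hz, triForm_neg_left, triForm_neg_left] at h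
    linear_combination (norm := module) h
  have ab₁ := mixed w₂ w₁ w₃ m₁ m₃ k₁ k₃
  have ab₂ := mixed w₃ w₂ w₁ m₂ m₁ k₂ k₁
  have ab₃ := mixed w₁ w₃ w₂ m₃ m₂ k₃ k₂
  have c₁ := triForm_leibniz_rotate hτ hE hE0 m₂ w₁ w₃
  have c₂ := triForm_leibniz_rotate hτ hE hE0 m₃ w₂ w₁
  have c₃ := triForm_leibniz_rotate hτ hE hE0 m₁ w₃ w₂
  have e : ∀ {q w m : R} (y z : R), q = a • N w + b • E m →
      triForm τ q y z = a • triForm τ (N w) y z + b • triForm τ (E m) y z := by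
    rintro q w m y z rfl
    exact triForm_add_smul a b _ _ y z
  rw [e _ _ h₂, e _ _ h₂, e _ _ h₃, e _ _ h₃, e _ _ h₁, e _ _ h₁]
  -- After `q = a N w + b E m` is inserted, the coefficients of `a²`, `b²` and `a b` vanish
  -- separately.
  linear_combination (norm := module) (a * a) • aa + (b * b) • bb + (a * b) • (ab₁ + ab₂ + ab₃ + c₁ + c₂ + c₃)

end LiePoisson

/-! ## Derivations and traces of quaternionic matrices -/

section QuaternionicMatrices

variable {A : Type v} [CommRing A] [Algebra ℝ A]

@[simp]
theorem dQ_re (D : Derivation ℝ A A) (a : ℍ[A]) : (dQ D a).re = D a.re := rfl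

@[simp]
theorem dQ_imI (D : Derivation ℝ A A) (a : ℍ[A]) : (dQ D a).imI = D a.imI := rfl

@[simp]
theorem dQ_imJ (D : Derivation ℝ A A) (a : ℍ[A]) : (dQ D a).imJ = D a.imJ := rfl

@[simp]
theorem dQ_imK (D : Derivation ℝ A A) (a : ℍ[A]) : (dQ D a).imK = D a.imK := rfl

theorem dQ_add (D : Derivation ℝ A A) (a b : ℍ[A]) : dQ D (a + b) = dQ D a + dQ D b := by
  ext <;> simp

theorem dQ_smul (D : Derivation ℝ A A) (c : ℝ) (a : ℍ[A]) : dQ D (c • a) = c • dQ D a := by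
  ext <;> simp

theorem dQ_mul (D : Derivation ℝ A A) (a b : ℍ[A]) : dQ D (a * b) = dQ D a * b + a * dQ D b := by
  ext <;> simp <;> ring

theorem dQ_zero (D : Derivation ℝ A A) : dQ D 0 = 0 := by
  ext <;> simp

theorem dQ_one (D : Derivation ℝ A A) : dQ D 1 = 0 := by
  ext <;> simp

theorem dQ_neg (D : Derivation ℝ A A) (a : ℍ[A]) : dQ D (-a) = -dQ D a := by
  ext <;> simp

theorem dQ_star (D : Derivation ℝ A A) (a : ℍ[A]) : dQ D (star a) = star (dQ D a) := by
  ext <;> simp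

theorem dQ_sub (D : Derivation ℝ A A) (a b : ℍ[A]) : dQ D (a - b) = dQ D a - dQ D b := by
  ext <;> simp

theorem dQ_coe (D : Derivation ℝ A A) (r : A) : dQ D (r : ℍ[A]) = ((D r : A) : ℍ[A]) := by
  ext <;> simp

/-- `dQ` as a linear map. -/
def dQLin (D : Derivation ℝ A A) : ℍ[A] →ₗ[ℝ] ℍ[A] where
  toFun := dQ D
  map_add' := dQ_add D
  map_smul' := dQ_smul D

theorem re_mul_comm (a b : ℍ[A]) : (a * b).re = (b * a).re := by
  simp only [Quaternion.re_mul]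
  ring

variable {ι : Type*}

/-- `dMat` as a linear map. -/
def dMatLin (D : Derivation ℝ A A) : Matrix ι ι ℍ[A] →ₗ[ℝ] Matrix ι ι ℍ[A] where
  toFun := dMat D
  map_add' M N := by
    ext1 i j
    exact dQ_add D _ _
  map_smul' c M := by
    ext1 i j
    exact dQ_smul D _ _

theorem dMatLin_apply (D : Derivation ℝ A A) (M : Matrix ι ι ℍ[A]) : dMatLin D M = dMat D M := rfl

theorem dMat_apply (D : Derivation ℝ A A) (M : Matrix ι ι ℍ[A]) (i j : ι) :
    dMat D M i j = dQ D (M i j) := rfl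

theorem dMat_comm {D E : Derivation ℝ A A} (h : ∀ a, D (E a) = E (D a)) (M : Matrix ι ι ℍ[A]) :
    dMat D (dMat E M) = dMat E (dMat D M) := by
  ext1 i j
  ext <;> simp [dMat, h]

theorem dMat_conjTranspose (D : Derivation ℝ A A) (M : Matrix ι ι ℍ[A]) :
    dMat D M.conjTranspose = (dMat D M).conjTranspose := by
  ext1 i j
  exact dQ_star D _

variable [Fintype ι]

theorem dMat_mul (D : Derivation ℝ A A) (M N : Matrix ι ι ℍ[A]) :
    dMat D (M * N) = dMat D M * N + M * dMat D N := by
  ext1 i j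
  change dQLin D _ = _
  simp only [Matrix.add_apply, Matrix.mul_apply, map_sum, ← Finset.sum_add_distrib]
  exact Finset.sum_congr rfl fun k _ => dQ_mul D _ _

theorem isLeibniz_dMatLin [DecidableEq ι] (D : Derivation ℝ A A) :
    IsLeibniz (dMatLin D : Matrix ι ι ℍ[A] →ₗ[ℝ] _) :=
  dMat_mul D

/-- The real part as a linear map. -/
def reLin : ℍ[A] →ₗ[ℝ] A where
  toFun q := q.re
  map_add' _ _ := rfl
  map_smul' _ _ := rfl

/-- The real part of the trace. -/
def reTrace : Matrix ι ι ℍ[A] →ₗ[ℝ] A := reLin ∘ₗ Matrix.traceLinearMap ι ℝ ℍ[A]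

theorem reTrace_eq_sum (M : Matrix ι ι ℍ[A]) : reTrace M = ∑ i, (M i i).re :=
  map_sum (reLin (A := A)) _ _

theorem reTrace_mul_comm (M N : Matrix ι ι ℍ[A]) : reTrace (M * N) = reTrace (N * M) := by
  simp only [reTrace_eq_sum, Matrix.mul_apply]
  have h : ∀ (f : ι → ℍ[A]), (∑ j, f j).re = ∑ j, (f j).re := fun f => map_sum (reLin (A := A)) _ _
  simp only [h]
  rw [Finset.sum_comm]
  exact Finset.sum_congr rfl fun i _ => Finset.sum_congr rfl fun j _ => re_mul_comm _ _

theorem reTrace_dMat (D : Derivation ℝ A A) (M : Matrix ι ι ℍ[A]) :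
    reTrace (dMat D M) = D (reTrace M) := by
  simp only [reTrace_eq_sum, map_sum]
  rfl

end QuaternionicMatrices

/-! ## Block matrices -/

section Blocks

variable {n : ℕ} {A : Type v} [CommRing A] [Algebra ℝ A]

/-- The skew-Hermitian block diagonal matrix with diagonal blocks `a` and `[b, c; -c̄ᵗ, V]`. -/
def hMat (a b : ℍ[A]) (c : Fin (n - 1) → ℍ[A]) (V : Matrix (Fin (n - 1)) (Fin (n - 1)) ℍ[A]) :
    Matrix (Idx n) (Idx n) ℍ[A]
  | Sum.inl _, Sum.inl _ => a
  | Sum.inr (Sum.inl _), Sum.inr (Sum.inl _) => b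
  | Sum.inr (Sum.inl _), Sum.inr (Sum.inr j) => c j
  | Sum.inr (Sum.inr i), Sum.inr (Sum.inl _) => -star (c i)
  | Sum.inr (Sum.inr i), Sum.inr (Sum.inr j) => V i j
  | Sum.inl _, Sum.inr _ => 0
  | Sum.inr _, Sum.inl _ => 0

theorem hPerpMat_eq_hMat (w : QField n A) : hPerpMat w = hMat (w.1 : ℍ[A]) (-w.1) w.2 0 := by
  ext1 i j
  rcases i with _ | _ | i <;> rcases j with _ | _ | j <;> rfl

theorem star_imH (a : imH A) : star (a : ℍ[A]) = -(a : ℍ[A]) := by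
  have h : (a : ℍ[A]).re = 0 := a.2
  ext <;> simp [h]

/-- Skew-Hermitian matrices are determined by the blocks on and above the diagonal, so the block
computations below check six blocks instead of nine. -/
theorem matrix_ext_blocks {M N : Matrix (Idx n) (Idx n) ℍ[A]}
    (h₁ : M (.inl ()) (.inl ()) = N (.inl ()) (.inl ()))
    (h₂ : M (.inl ()) (.inr (.inl ())) = N (.inl ()) (.inr (.inl ())))
    (h₃ : ∀ j, M (.inl ()) (.inr (.inr j)) = N (.inl ()) (.inr (.inr j)))
    (h₄ : M (.inr (.inl ())) (.inr (.inl ())) = N (.inr (.inl ())) (.inr (.inl ())))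
    (h₅ : ∀ j, M (.inr (.inl ())) (.inr (.inr j)) = N (.inr (.inl ())) (.inr (.inr j)))
    (h₆ : ∀ i j, M (.inr (.inr i)) (.inr (.inr j)) = N (.inr (.inr i)) (.inr (.inr j)))
    (hM : M.conjTranspose = -M) (hN : N.conjTranspose = -N) : M = N := by
  have hs : ∀ i j, M i j = N i j → M j i = N j i := by
    intro i j h
    have a := congrFun (congrFun hM j) i
    have b := congrFun (congrFun hN j) i
    simp only [Matrix.conjTranspose_apply, Matrix.neg_apply] at a b
    rw [← neg_inj, ← a, ← b, h]
  ext1 i j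
  rcases i with ⟨⟩ | ⟨⟩ | i <;> rcases j with ⟨⟩ | ⟨⟩ | j
  · exact h₁
  · exact h₂
  · exact h₃ j
  · exact hs _ _ h₂
  · exact h₄
  · exact h₅ j
  · exact hs _ _ (h₃ i)
  · exact hs _ _ (h₅ i)
  · exact h₆ i j

theorem conjTranspose_hMat {a b : ℍ[A]} {c : Fin (n - 1) → ℍ[A]}
    {V : Matrix (Fin (n - 1)) (Fin (n - 1)) ℍ[A]} (ha : star a = -a) (hb : star b = -b)
    (hV : V.conjTranspose = -V) : (hMat a b c V).conjTranspose = -hMat a b c V := by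
  ext1 i j
  rcases i with _ | _ | i <;> rcases j with _ | _ | j <;>
    simp [hMat, Matrix.conjTranspose_apply, ha, hb]
  exact congrFun (congrFun hV i) j

theorem conjTranspose_mMat (m : ℍ[A]) (mv : Fin (n - 1) → ℍ[A]) :
    (mMat m mv).conjTranspose = -mMat m mv := by
  ext1 i j
  rcases i with _ | _ | i <;> rcases j with _ | _ | j <;>
    simp [mMat, Matrix.conjTranspose_apply]

theorem conjTranspose_hPerpMat (w : QField n A) : (hPerpMat w).conjTranspose = -hPerpMat w := by
  rw [hPerpMat_eq_hMat]
  apply conjTranspose_hMat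
  · exact star_imH _
  · rw [star_neg, star_imH]
  · simp

theorem conjTranspose_dMat {ι : Type*} (D : Derivation ℝ A A) {M : Matrix ι ι ℍ[A]}
    (hM : M.conjTranspose = -M) : (dMat D M).conjTranspose = -dMat D M := by
  rw [← dMat_conjTranspose, hM]
  exact map_neg (dMatLin D) M

theorem conjTranspose_commutator {ι : Type*} [Fintype ι] {M N : Matrix ι ι ℍ[A]}
    (hM : M.conjTranspose = -M) (hN : N.conjTranspose = -N) :
    (M * N - N * M).conjTranspose = -(M * N - N * M) := by
  simp [Matrix.conjTranspose_sub, Matrix.conjTranspose_mul, hM, hN]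

theorem pairing_eq_reLin (a b : QField n A) :
    pairing a b = reLin ((a.1 : ℍ[A]) * star (b.1 : ℍ[A]) + herm a.2 b.2) := rfl

/-- Against `𝔥_⊥` the trace form sees only `a - b` and `c`; the entries `a + b` and `V` are
orthogonal to it. The factor is `-2` because the diagonal gives `z (a - b)` and each off-diagonal
product occurs twice. -/
theorem reTrace_hPerpMat_mul (z : QField n A) (a b : ℍ[A]) (c : Fin (n - 1) → ℍ[A])
    (V : Matrix (Fin (n - 1)) (Fin (n - 1)) ℍ[A]) (w : imH A)
    (hw : a - b = (2 : ℝ) • (w : ℍ[A])) :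
    reTrace (hPerpMat z * hMat a b c V) = -((2 : ℝ) • pairing z (w, c)) := by
  have h1 : reLin ((z.1 : ℍ[A]) * a) - reLin ((z.1 : ℍ[A]) * b)
      = -((2 : ℝ) • reLin ((z.1 : ℍ[A]) * star (w : ℍ[A]))) := by
    rw [star_imH, mul_neg, map_neg, smul_neg, neg_neg, ← map_smul, ← mul_smul_comm, ← hw, mul_sub,
      map_sub]
  have h2 : ∀ x y : ℍ[A], reLin (star x * y) = reLin (x * star y) := by
    intro x y
    change (star x * y).re = (x * star y).re
    simp
  have h4 : reTrace (hPerpMat z * hMat a b c V)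
      = ∑ i, reLin ((hPerpMat z * hMat a b c V) i i) := reTrace_eq_sum _
  rw [pairing_eq_reLin, h4]
  simp only [Matrix.mul_apply, Fintype.sum_sum_type, Finset.univ_unique,
    Finset.sum_singleton, hPerpMat, hMat, zero_mul, mul_zero, map_zero, Finset.sum_const_zero, add_zero,
    zero_add, herm, map_add, map_sum, mul_neg, neg_mul, map_neg, h2, Finset.sum_neg_distrib]
  linear_combination (norm := module) h1

variable (D : Derivation ℝ A A)

theorem covariant_hMat (u : QField n A) {a b : ℍ[A]} {c : Fin (n - 1) → ℍ[A]}
    {V : Matrix (Fin (n - 1)) (Fin (n - 1)) ℍ[A]} (ha : star a = -a) (hb : star b = -b)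
    (hV : V.conjTranspose = -V) :
    dMat D (hMat a b c V) + (hPerpMat u * hMat a b c V - hMat a b c V * hPerpMat u)
      = hMat (dQ D a + ((u.1 : ℍ[A]) * a - a * (u.1 : ℍ[A])))
          (dQ D b - ((u.1 : ℍ[A]) * b - b * (u.1 : ℍ[A])) - (herm u.2 c - herm c u.2))
          (fun i => dQ D (c i) - (u.1 : ℍ[A]) * c i + Matrix.vecMul u.2 V i - b * u.2 i)
          (dMat D V - opCm u.2 c) := by
  have h0 := conjTranspose_hMat (c := c) ha hb hV
  apply matrix_ext_blocks
  · simp [Matrix.mul_apply, Fintype.sum_sum_type, hPerpMat, hMat, dMat_apply]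
  · simp [Matrix.mul_apply, Fintype.sum_sum_type, hPerpMat, hMat, dMat_apply, dQ_zero]
  · intro j
    simp [Matrix.mul_apply, Fintype.sum_sum_type, hPerpMat, hMat, dMat_apply, dQ_zero]
  · simp [Matrix.mul_apply, Fintype.sum_sum_type, hPerpMat, hMat, dMat_apply, herm]
    abel
  · intro j
    simp [Matrix.mul_apply, Fintype.sum_sum_type, hPerpMat, hMat, dMat_apply, Matrix.vecMul,
      dotProduct]
    abel
  · intro i j
    simp [Matrix.mul_apply, Fintype.sum_sum_type, hPerpMat, hMat, dMat_apply, opCm]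
    abel
  · rw [Matrix.conjTranspose_add, conjTranspose_dMat D h0,
      conjTranspose_commutator (conjTranspose_hPerpMat u) h0, neg_add]
  · apply conjTranspose_hMat
    · rw [star_add, star_sub, star_mul, star_mul, ← dQ_star, ha, star_imH, dQ_neg]
      noncomm_ring
    · have hh : ∀ x y : Fin (n - 1) → ℍ[A], star (herm x y) = herm y x := by
        intro x y
        simp [herm]
      rw [star_sub, star_sub, star_sub, star_sub, star_mul, star_mul, ← dQ_star, hb, star_imH,
        dQ_neg, hh, hh]
      noncomm_ring
    · rw [Matrix.conjTranspose_sub, conjTranspose_dMat D hV]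
      ext1 i j
      simp [opCm, Matrix.conjTranspose_apply]
      abel

theorem covariant_mMat (u : QField n A) (m : ℍ[A]) (mv : Fin (n - 1) → ℍ[A]) :
    dMat D (mMat m mv) + (hPerpMat u * mMat m mv - mMat m mv * hPerpMat u)
      = mMat (dQ D m + ((u.1 : ℍ[A]) * m + m * (u.1 : ℍ[A])) + herm mv u.2)
          (fun i => dQ D (mv i) + (u.1 : ℍ[A]) * mv i - m * u.2 i) := by
  apply matrix_ext_blocks
  · simp [Matrix.mul_apply, Fintype.sum_sum_type, hPerpMat, mMat, dMat_apply, dQ_zero]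
  · simp [Matrix.mul_apply, Fintype.sum_sum_type, hPerpMat, mMat, dMat_apply, herm]
    abel
  · intro j
    simp [Matrix.mul_apply, Fintype.sum_sum_type, hPerpMat, mMat, dMat_apply]
    abel
  · simp [Matrix.mul_apply, Fintype.sum_sum_type, hPerpMat, mMat, dMat_apply, dQ_zero]
  · intro j
    simp [Matrix.mul_apply, Fintype.sum_sum_type, hPerpMat, mMat, dMat_apply, dQ_zero]
  · intro i j
    simp [Matrix.mul_apply, Fintype.sum_sum_type, hPerpMat, mMat, dMat_apply, dQ_zero]
  · rw [Matrix.conjTranspose_add, conjTranspose_dMat D (conjTranspose_mMat m mv),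
      conjTranspose_commutator (conjTranspose_hPerpMat u) (conjTranspose_mMat m mv), neg_add]
  · exact conjTranspose_mMat _ _

/-- The matrices with `a = b` and `c = 0` form the centralizer of `e` in `𝔥`, which is where the
nonlocal variables `p` and `V` of `𝓗` sit. -/
theorem commutator_mMat_hMat {a b : ℍ[A]} {c : Fin (n - 1) → ℍ[A]}
    {V : Matrix (Fin (n - 1)) (Fin (n - 1)) ℍ[A]} (ha : star a = -a) (hb : star b = -b)
    (hV : V.conjTranspose = -V) :
    mMat 1 0 * hMat a b c V - hMat a b c V * mMat 1 0 = mMat (b - a) c := by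
  apply matrix_ext_blocks
  · simp [Matrix.mul_apply, Fintype.sum_sum_type, hMat, mMat]
  · simp [Matrix.mul_apply, Fintype.sum_sum_type, hMat, mMat]
  · intro j
    simp [Matrix.mul_apply, Fintype.sum_sum_type, hMat, mMat]
  · simp [Matrix.mul_apply, Fintype.sum_sum_type, hMat, mMat]
  · intro j
    simp [Matrix.mul_apply, Fintype.sum_sum_type, hMat, mMat]
  · intro i j
    simp [Matrix.mul_apply, Fintype.sum_sum_type, hMat, mMat]
  · exact conjTranspose_commutator (conjTranspose_mMat _ _) (conjTranspose_hMat ha hb hV)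
  · exact conjTranspose_mMat _ _

/-- The real part of `m` drops out: it is the component along `e`, which is where the nonlocal
variable `r` of `𝓙` sits. -/
theorem commutator_mMat_mMat (m : ℍ[A]) (mv : Fin (n - 1) → ℍ[A]) :
    mMat 1 0 * mMat m mv - mMat m mv * mMat 1 0 = hMat (m - star m) (star m - m) (-mv) 0 := by
  apply matrix_ext_blocks
  · simp [Matrix.mul_apply, Fintype.sum_sum_type, hMat, mMat]
    abel
  · simp [Matrix.mul_apply, Fintype.sum_sum_type, hMat, mMat]
  · intro j
    simp [Matrix.mul_apply, Fintype.sum_sum_type, hMat, mMat]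
  · simp [Matrix.mul_apply, Fintype.sum_sum_type, hMat, mMat]
    abel
  · intro j
    simp [Matrix.mul_apply, Fintype.sum_sum_type, hMat, mMat]
  · intro i j
    simp [Matrix.mul_apply, Fintype.sum_sum_type, hMat, mMat]
  · exact conjTranspose_commutator (conjTranspose_mMat _ _) (conjTranspose_mMat _ _)
  · apply conjTranspose_hMat <;> simp

end Blocks

/-! ## Symplectic and Hamiltonian operators from covariant derivatives -/

section JetForms

variable {n : ℕ}

theorem dMat_hPerpMat {A : Type v} [CommRing A] [Algebra ℝ A] (D : Derivation ℝ A A)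
    (w : QField n A) : dMat D (hPerpMat w) = hPerpMat (dField D w) := by
  ext1 i j
  rcases i with _ | _ | i <;> rcases j with _ | _ | j <;>
    simp [dMat_apply, hPerpMat, dField, dIm, dQ_zero, dQ_neg, dQ_star]

theorem dMat_lie {A : Type v} [CommRing A] [Algebra ℝ A] {ι : Type*} (X Y : Derivation ℝ A A)
    (M : Matrix ι ι ℍ[A]) : dMat ⁅X, Y⁆ M = dMat X (dMat Y M) - dMat Y (dMat X M) := by
  ext1 i j
  ext <;> simp [dMat, Derivation.commutator_apply]

theorem pairing_comm {A : Type v} [CommRing A] [Algebra ℝ A] (a b : QField n A) :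
    pairing a b = pairing b a := by
  have h : ∀ x y : ℍ[A], reLin (x * star y) = reLin (y * star x) := by
    intro x y
    change (x * star y).re = (y * star x).re
    simp
    ring
  rw [pairing_eq_reLin, pairing_eq_reLin]
  simp only [map_add, herm, map_sum]
  rw [h]
  congr 1
  exact Finset.sum_congr rfl fun i _ => h _ _

/-! ### Trace functional and covariant derivative on a jet space -/

namespace JetAlgebra

variable (J : JetAlgebra.{v} n)

/-- The functional with density the real part of the trace of a matrix. -/
def traceFunctional : Matrix (Idx n) (Idx n) ℍ[J.carrier] →ₗ[ℝ] J.Functional :=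
  Submodule.mkQ _ ∘ₗ reTrace

theorem traceFunctional_apply (M : Matrix (Idx n) (Idx n) ℍ[J.carrier]) :
    J.traceFunctional M = J.integral (reTrace M) := rfl

theorem traceFunctional_mul_comm (M N : Matrix (Idx n) (Idx n) ℍ[J.carrier]) :
    J.traceFunctional (M * N) = J.traceFunctional (N * M) := by
  rw [traceFunctional_apply, traceFunctional_apply, reTrace_mul_comm]

theorem integral_D (a : J.carrier) : J.integral (J.D a) = 0 :=
  (Submodule.Quotient.mk_eq_zero _).2 ⟨a, rfl⟩

theorem act_integral (X : J.vf) (a : J.carrier) : J.act X (J.integral a) = J.integral (X.1 a) := rfl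

theorem act_traceFunctional (X : J.vf) (M : Matrix (Idx n) (Idx n) ℍ[J.carrier]) :
    J.act X (J.traceFunctional M) = J.traceFunctional (dMat X.1 M) := by
  rw [traceFunctional_apply, traceFunctional_apply, act_integral, reTrace_dMat]

theorem act_lie (X Y : J.vf) (F : J.Functional) :
    J.act ⁅X, Y⁆ F = J.act X (J.act Y F) - J.act Y (J.act X F) := by
  obtain ⟨a, rfl⟩ := Submodule.mkQ_surjective _ F
  change J.integral (⁅X.1, Y.1⁆ a) = J.integral (X.1 (Y.1 a)) - J.integral (Y.1 (X.1 a))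
  rw [Derivation.commutator_apply]
  rfl

theorem hPerpMat_comps (X : J.vf) : hPerpMat (J.comps X) = dMat X.1 (hPerpMat J.u) :=
  (dMat_hPerpMat _ _).symm

/-- The covariant derivative `D + ad (hPerpMat u)`. -/
def covDer : Matrix (Idx n) (Idx n) ℍ[J.carrier] →ₗ[ℝ] Matrix (Idx n) (Idx n) ℍ[J.carrier] :=
  dMatLin J.D + innerDer (hPerpMat J.u)

theorem covDer_apply (M : Matrix (Idx n) (Idx n) ℍ[J.carrier]) :
    J.covDer M = dMat J.D M + (hPerpMat J.u * M - M * hPerpMat J.u) := rfl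

theorem isLeibniz_covDer : IsLeibniz J.covDer :=
  (isLeibniz_dMatLin J.D).add (isLeibniz_innerDer _)

theorem traceFunctional_covDer (M : Matrix (Idx n) (Idx n) ℍ[J.carrier]) :
    J.traceFunctional (J.covDer M) = 0 := by
  rw [covDer, LinearMap.add_apply, map_add, trace_innerDer J.traceFunctional_mul_comm, add_zero,
    dMatLin_apply, traceFunctional_apply, reTrace_dMat, integral_D]

/-- Since `X` commutes with the total derivative, the only contribution to `[X, ∇]` is the variation
of the connection matrix. -/
theorem dMat_covDer (X : J.vf) (M : Matrix (Idx n) (Idx n) ℍ[J.carrier]) :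
    dMatLin X.1 (J.covDer M)
      = J.covDer (dMatLin X.1 M) + innerDer (hPerpMat (J.comps X)) M := by
  simp only [covDer, LinearMap.add_apply, innerDer_apply, map_add, map_sub, hPerpMat_comps,
    dMatLin_apply, dMat_mul, dMat_comm (J.vf_comm X.1 X.2)]
  abel

/-- The real multiple `ε (1, 𝟎)` of the constant matrix `(1, 𝟎) ∈ 𝔪`. -/
def unitM (ε : ℝ) : Matrix (Idx n) (Idx n) ℍ[J.carrier] := ε • mMat 1 0

theorem dMat_unitM (X : Derivation ℝ J.carrier J.carrier) (ε : ℝ) : dMat X (J.unitM ε) = 0 := by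
  rw [unitM, ← dMatLin_apply, map_smul, dMatLin_apply]
  convert smul_zero ε
  ext1 i j
  rcases i with _ | _ | i <;> rcases j with _ | _ | j <;>
    simp [dMat_apply, mMat, dQ_zero, dQ_neg, dQ_one]

theorem dMat_innerDer_unitM (X : Derivation ℝ J.carrier J.carrier) (ε : ℝ)
    (M : Matrix (Idx n) (Idx n) ℍ[J.carrier]) :
    dMatLin X (innerDer (J.unitM ε) M) = innerDer (J.unitM ε) (dMatLin X M) := by
  simp only [innerDer_apply, map_sub, dMatLin_apply, dMat_mul, dMat_unitM, zero_mul, mul_zero,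
    zero_add, add_zero]

end JetAlgebra

/-! ### Two-forms defined by potentials -/

namespace NonlocalOp

open JetAlgebra

/-- `Ω + μ` is a potential for the pair `(y, v)`: with the covariant derivative `∇`,
`y = a ∇Ω + b [e, μ]`, `∇μ + [e, Ω] = 0`, and `v` represents pairing with `Ω`. -/
structure IsPotential (a b ε : ℝ) (J : JetAlgebra.{v} n) (y v : J.Field)
    (Ω μ : Matrix (Idx n) (Idx n) ℍ[J.carrier]) : Prop where
  eq_h : hPerpMat y = a • J.covDer Ω + b • innerDer (J.unitM ε) μ
  eq_m : J.covDer μ = -innerDer (J.unitM ε) Ω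
  pairing_eq : ∀ z : J.Field, reTrace (hPerpMat z * Ω) = -((2 : ℝ) • pairing z v)

theorem IsPotential.integral_pairing {a b ε : ℝ} {J : JetAlgebra.{v} n} {y v : J.Field}
    {Ω μ : Matrix (Idx n) (Idx n) ℍ[J.carrier]} (h : IsPotential a b ε J y v Ω μ) (z : J.Field) :
    J.integral (pairing z v) = (-1 / 2 : ℝ) • J.traceFunctional (hPerpMat z * Ω) := by
  rw [traceFunctional_apply, h.pairing_eq]
  change Submodule.mkQ _ _ = (-1 / 2 : ℝ) • Submodule.mkQ _ _
  rw [← map_smul]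
  congr 1
  module

/-- An operator all of whose pairs admit potentials is symplectic. -/
theorem isSymplectic_of_potential {P : NonlocalOp.{v} n} (a b ε : ℝ)
    (hP : ∀ (J : JetAlgebra.{v} n) (y v : J.Field), P J y v → ∃ Ω μ, IsPotential a b ε J y v Ω μ) :
    IsSymplectic P := by
  intro J
  have hE := isLeibniz_innerDer (J.unitM ε)
  have hE0 := trace_innerDer (τ := J.traceFunctional) J.traceFunctional_mul_comm (J.unitM ε)
  refine ⟨?_, ?_⟩
  · intro X₁ X₂ v₁ v₂ h₁ h₂
    obtain ⟨Ω₁, μ₁, p₁⟩ := hP J _ _ h₁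
    obtain ⟨Ω₂, μ₂, p₂⟩ := hP J _ _ h₂
    rw [p₁.integral_pairing, p₂.integral_pairing,
      liePoisson_skew J.traceFunctional_mul_comm J.isLeibniz_covDer hE J.traceFunctional_covDer hE0
        a b p₁.eq_h p₂.eq_h p₁.eq_m p₂.eq_m, smul_neg]
  · intro X₁ X₂ X₃ v₁ v₂ v₃ h₁ h₂ h₃
    obtain ⟨Ω₁, μ₁, p₁⟩ := hP J _ _ h₁
    obtain ⟨Ω₂, μ₂, p₂⟩ := hP J _ _ h₂
    obtain ⟨Ω₃, μ₃, p₃⟩ := hP J _ _ h₃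
    have key := liePoisson_closed J.traceFunctional_mul_comm J.isLeibniz_covDer hE
      J.traceFunctional_covDer hE0 a b (J.dMat_covDer X₁) (J.dMat_covDer X₂) (J.dMat_covDer X₃)
      (J.dMat_innerDer_unitM _ ε) (J.dMat_innerDer_unitM _ ε) (J.dMat_innerDer_unitM _ ε)
      p₁.eq_h p₂.eq_h p₃.eq_h p₁.eq_m p₂.eq_m p₃.eq_m
    -- By the product rule and `[X, Y] Q = X (Y Q) - Y (X Q)`, the derivatives `X (Y Q)` cancel;
    -- what is left has the shape of the summands in `liePoisson_closed`.
    have term : ∀ (X Y : J.vf) {y v : J.Field} {Ω μ : Matrix (Idx n) (Idx n) ℍ[J.carrier]},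
        IsPotential a b ε J y v Ω μ →
        J.act X (J.integral (pairing (J.comps Y) v)) - J.integral (pairing (J.comps ⁅X, Y⁆) v)
          = (-1 / 2 : ℝ) • (J.traceFunctional (dMatLin Y.1 (hPerpMat (J.comps X)) * Ω)
            + J.traceFunctional (hPerpMat (J.comps Y) * dMatLin X.1 Ω)) := by
      intro X Y y v Ω μ p
      have hl : hPerpMat (J.comps ⁅X, Y⁆) = dMat X.1 (hPerpMat (J.comps Y))
          - dMat Y.1 (hPerpMat (J.comps X)) := by
        rw [hPerpMat_comps, hPerpMat_comps, hPerpMat_comps]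
        exact dMat_lie _ _ _
      rw [p.integral_pairing, p.integral_pairing, map_smul, act_traceFunctional, dMat_mul, hl,
        sub_mul, map_add, map_sub, dMatLin_apply, dMatLin_apply]
      module
    rw [term X₁ X₂ p₃, term X₂ X₃ p₁, term X₃ X₁ p₂, ← smul_add, ← smul_add, key, smul_zero]

/-- An operator with symplectic inverse is Hamiltonian. -/
theorem isHamiltonian_of_inverse {P : NonlocalOp.{v} n} (hP : IsSymplectic P.inverse) :
    IsHamiltonian P := by
  intro J
  obtain ⟨hs, hc⟩ := hP J
  have hpo : ∀ F G : HamFunctional P J, poisson F G = J.act G.vec F.val := fun F G =>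
    (F.isVarDeriv G.vec).symm
  have hin : ∀ (X : J.vf) (F : HamFunctional P J),
      J.integral (pairing (J.comps X) F.grad) = J.act X F.val := by
    intro X F
    rw [F.isVarDeriv X, pairing_comm]
  refine ⟨?_, ?_⟩
  · intro F G
    have h := hs G.vec F.vec G.grad F.grad G.vec_eq F.vec_eq
    rwa [hin, hin, ← hpo, ← hpo] at h
  · intro F G K
    -- Pairing with a gradient is differentiation of the functional, so `X ω(Y, ·) - ω([X, Y], ·)`
    -- evaluated on `F` is `X Y F - [X, Y] F = Y X F`. The cyclic sum is then the Jacobi sum.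
    have h := hc G.vec K.vec F.vec G.grad K.grad F.grad G.vec_eq K.vec_eq F.vec_eq
    simp only [hin, act_lie] at h
    simp only [hpo]
    rw [← h]
    abel

/-- Linear combinations of symplectic operators are symplectic. -/
theorem IsSymplectic.comb {P Q : NonlocalOp.{v} n} (hP : IsSymplectic P) (hQ : IsSymplectic Q)
    (c₁ c₂ : ℝ) : IsSymplectic (comb c₁ c₂ P Q) := by
  intro J
  have lin : ∀ y v w : J.Field, J.integral (pairing y (c₁ • v + c₂ • w))
      = c₁ • J.integral (pairing y v) + c₂ • J.integral (pairing y w) := by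
    intro y v w
    have h : pairing y (c₁ • v + c₂ • w) = c₁ • pairing y v + c₂ • pairing y w := by
      have hstar : ∀ (r : ℝ) (q : ℍ[J.carrier]), star (r • q) = r • star q := by
        intro r q
        ext <;> simp
      rw [pairing_eq_reLin, pairing_eq_reLin, pairing_eq_reLin, ← map_smul, ← map_smul, ← map_add]
      congr 1
      simp only [herm, Prod.fst_add, Prod.snd_add, Prod.smul_fst, Prod.smul_snd, Pi.add_apply,
        Pi.smul_apply, Submodule.coe_add, Submodule.coe_smul, star_add, hstar, mul_add,
        mul_smul_comm, Finset.sum_add_distrib, Finset.smul_sum, smul_add]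
      abel
    rw [h]
    rfl
  refine ⟨?_, ?_⟩
  · rintro X₁ X₂ _ _ ⟨v₁, w₁, a₁, b₁, rfl⟩ ⟨v₂, w₂, a₂, b₂, rfl⟩
    rw [lin, lin, (hP J).1 X₁ X₂ v₁ v₂ a₁ a₂, (hQ J).1 X₁ X₂ w₁ w₂ b₁ b₂]
    module
  · rintro X₁ X₂ X₃ _ _ _ ⟨v₁, w₁, a₁, b₁, rfl⟩ ⟨v₂, w₂, a₂, b₂, rfl⟩ ⟨v₃, w₃, a₃, b₃, rfl⟩
    have hp := (hP J).2 X₁ X₂ X₃ v₁ v₂ v₃ a₁ a₂ a₃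
    have hq := (hQ J).2 X₁ X₂ X₃ w₁ w₂ w₃ b₁ b₂ b₃
    simp only [lin, map_add, map_smul]
    linear_combination (norm := module) c₁ • hp + c₂ • hq

end NonlocalOp

end JetForms

/-! ## Potentials for the operators -/

section Potentials

variable {n : ℕ} {A : Type v} [CommRing A] [Algebra ℝ A]

theorem hPerpMat_smul_add_smul (c₁ c₂ : ℝ) (v₁ v₂ : QField n A) :
    hPerpMat (c₁ • v₁ + c₂ • v₂) = c₁ • hPerpMat v₁ + c₂ • hPerpMat v₂ := by
  have hstar : ∀ (r : ℝ) (q : ℍ[A]), star (r • q) = r • star q := by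
    intro r q
    ext <;> simp
  ext1 i j
  rcases i with _ | _ | i <;> rcases j with _ | _ | j <;> simp [hPerpMat, hstar] <;> abel

theorem coe_mul_comm_quaternion (r : A) (q : ℍ[A]) : (r : ℍ[A]) * q = q * (r : ℍ[A]) :=
  Quaternion.coe_commutes r q

/-- The centralizer entries of `Ω` are chosen so that `∇Ω` stays in `𝔥_⊥`; this requirement is what
the equations for `D p` and `D V` express. -/
theorem hamRel.exists_potential {D : Derivation ℝ A A} {u w v : QField n A}
    (hw : hamRel D u w v) :
    ∃ Ω : Matrix (Idx n) (Idx n) ℍ[A],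
      dMat D Ω + (hPerpMat u * Ω - Ω * hPerpMat u) = hPerpMat v ∧
      mMat 1 0 * Ω - Ω * mMat 1 0 = mMat (-((2 : ℝ) • (w.1 : ℍ[A]))) w.2 ∧
      ∀ z : QField n A, reTrace (hPerpMat z * Ω) = -((2 : ℝ) • pairing z w) := by
  obtain ⟨p, V, hV, hp, hDV, h₁, h₂⟩ := hw
  have ha : star ((w.1 : ℍ[A]) - p) = -((w.1 : ℍ[A]) - p) := by
    rw [star_sub, star_imH, star_imH]
    abel
  have hb : star (-(w.1 : ℍ[A]) - p) = -(-(w.1 : ℍ[A]) - p) := by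
    rw [star_sub, star_neg, star_imH, star_imH]
    abel
  -- The diagonal entries `±w - p` have half-difference `w` and common part `-p`.
  refine ⟨hMat ((w.1 : ℍ[A]) - p) (-(w.1 : ℍ[A]) - p) w.2 V, ?_, ?_, ?_⟩
  · rw [covariant_hMat D u ha hb hV, hPerpMat_eq_hMat]
    congr 1
    · rw [h₁, dQ_sub, hp]
      simp only [opC, opCv, mul_sub, sub_mul]
      abel
    · rw [h₁, dQ_sub, dQ_neg, hp]
      simp only [opC, opCv, mul_sub, sub_mul, mul_neg, neg_mul]
      module
    · rw [h₂]
      funext i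
      simp only [opR, opL, opLm, Pi.add_apply, Pi.sub_apply, sub_mul, neg_mul]
      abel
    · rw [hDV, sub_self]
  · rw [commutator_mMat_hMat ha hb hV]
    congr 1
    module
  · intro z
    exact reTrace_hPerpMat_mul z _ _ _ _ w.1 (by module)

/-- The condition `[e, μ] = h` fixes `μ` up to a real multiple of `e`. The equation for `D r`
removes the real part of the scalar entry of `∇μ`, and the two equations for `w` are the remaining
entries. -/
theorem sympRel.exists_potential {D : Derivation ℝ A A} {u h w : QField n A}
    (hw : sympRel D u h w) :
    ∃ μ : Matrix (Idx n) (Idx n) ℍ[A],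
      mMat 1 0 * μ - μ * mMat 1 0 = hPerpMat h ∧
      dMat D μ + (hPerpMat u * μ - μ * hPerpMat u) = mMat ((2 : ℝ) • (w.1 : ℍ[A])) (-w.2) := by
  obtain ⟨r, hr, h₁, h₂⟩ := hw
  have hstar : ∀ (r : ℝ) (q : ℍ[A]), star (r • q) = r • star q := by
    intro r q
    ext <;> simp
  have hherm : ∀ x y : Fin (n - 1) → ℍ[A], herm (-x) y = -herm x y := by
    intro x y
    simp [herm]
  refine ⟨mMat ((1 / 2 : ℝ) • (h.1 : ℍ[A]) - (r : ℍ[A])) (-h.2), ?_, ?_⟩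
  · rw [commutator_mMat_mMat, hPerpMat_eq_hMat, star_sub, hstar, star_imH, Quaternion.star_coe,
      neg_neg]
    congr 1 <;> module
  · rw [covariant_mMat]
    have hc := coe_mul_comm_quaternion r (u.1 : ℍ[A])
    congr 1
    · rw [h₁, dQ_sub, dQ_coe, hr, dQ_smul, hherm]
      simp only [opA, opAv, opCv, mul_sub, sub_mul, mul_smul_comm, smul_mul_assoc, hc]
      module
    · rw [h₂]
      funext i
      simp only [opR, opL, Pi.add_apply, Pi.sub_apply, Pi.neg_apply, Pi.smul_apply, dQ_neg, sub_mul,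
        smul_mul_assoc, mul_neg]
      module

end Potentials

/-! ### Potentials for the two inverse operators and their pencil -/

section Operators

variable {n : ℕ}

open NonlocalOp JetAlgebra

theorem isSymplectic_inverse_opH : IsSymplectic (opH.{v} n).inverse := by
  -- With `ε = 0` the constraint between `μ` and `Ω` is void, so `μ = 0` is allowed.
  refine isSymplectic_of_potential 1 0 0 fun J y v h => ?_
  obtain ⟨Ω, h₁, -, h₃⟩ := hamRel.exists_potential h
  refine ⟨Ω, 0, ?_, ?_, h₃⟩
  · rw [zero_smul, add_zero, one_smul, covDer_apply, h₁]
  · simp [unitM, innerDer_apply]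

theorem isSymplectic_opJ : IsSymplectic (opJ.{v} n) := by
  -- With `a = 0` no condition is put on `∇Ω`, so `Ω` can be taken in `𝔥_⊥` without nonlocal
  -- entries.
  refine isSymplectic_of_potential 0 1 1 fun J y v h => ?_
  obtain ⟨μ, h₁, h₂⟩ := sympRel.exists_potential h
  refine ⟨hPerpMat v, μ, ?_, ?_, ?_⟩
  · rw [zero_smul, zero_add, one_smul, innerDer_apply, unitM, one_smul, h₁]
  · rw [covDer_apply, h₂, innerDer_apply, unitM, one_smul, hPerpMat_eq_hMat,
      commutator_mMat_hMat (star_imH _) (by rw [star_neg, star_imH]) (by simp)]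
    ext1 i j
    rcases i with _ | _ | i <;> rcases j with _ | _ | j <;> simp [mMat, two_smul]
  · intro z
    rw [hPerpMat_eq_hMat v]
    exact reTrace_hPerpMat_mul z _ _ _ _ v.1 (by module)

/-- The potentials of the two operators fit together: `[e, Ω]` and `∇μ` both depend only on the
common covector `v`, and they are opposite. -/
theorem isSymplectic_inverse_comb (c₁ c₂ : ℝ) :
    IsSymplectic (comb c₁ c₂ (opH.{v} n) (opJ.{v} n).inverse).inverse := by
  refine isSymplectic_of_potential c₁ c₂ 1 fun J y v h => ?_
  obtain ⟨v₁, v₂, hH, hJ, rfl⟩ := h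
  obtain ⟨Ω, h₁, h₂, h₃⟩ := hamRel.exists_potential hH
  obtain ⟨μ, k₁, k₂⟩ := sympRel.exists_potential hJ
  refine ⟨Ω, μ, ?_, ?_, h₃⟩
  · rw [hPerpMat_smul_add_smul, covDer_apply, h₁, innerDer_apply, unitM, one_smul, k₁]
  · rw [covDer_apply, k₂, innerDer_apply, unitM, one_smul, h₂]
    ext1 i j
    rcases i with _ | _ | i <;> rcases j with _ | _ | j <;> simp [mMat]

theorem compatible_opH_opJ : Compatible (opH.{v} n) (opJ.{v} n) :=
  ⟨fun c₁ c₂ => isHamiltonian_of_inverse (isSymplectic_inverse_comb c₁ c₂),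
    fun c₁ c₂ => isSymplectic_inverse_opH.comb isSymplectic_opJ c₁ c₂⟩

end Operators

/-! ## The flow of a parallel moving frame -/

namespace SmoothFn

variable {U : TopologicalSpace.Opens (ℝ × ℝ)}

/-- Symmetry of the second derivative; only germs at points of the open set `U` matter, so the
extension by zero is harmless. -/
theorem dir_comm (e e' : ℝ × ℝ) (f : SmoothFn U) : dir e (dir e' f) = dir e' (dir e f) := by
  have hf : ContDiffOn ℝ ∞ (ext f) (U : Set (ℝ × ℝ)) := f.2
  have key : ∀ (a b : ℝ × ℝ) (p : U),
      (dir a (dir b f)).1 p = fderiv ℝ (fderiv ℝ (ext f)) p a b := by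
    intro a b p
    have hd : DifferentiableAt ℝ (fderiv ℝ (ext f)) p :=
      ((((contDiffOn_infty_iff_fderiv_of_isOpen U.isOpen).1 hf).2.contDiffAt
        (U.isOpen.mem_nhds p.2)).differentiableAt (by simp))
    change fderiv ℝ (ext (dir b f)) p a = _
    rw [(eventuallyEq_ext (f := dir b f) (g := fun q => fderiv ℝ (ext f) q b)
      (fun _ => rfl) p).fderiv_eq, fderiv_clm_apply hd (differentiableAt_const b)]
    simp
  apply Subtype.ext
  funext p
  rw [key, key]
  exact ((hf.contDiffAt (U.isOpen.mem_nhds p.2)).isSymmSndFDerivAt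
    (by rw [minSmoothness_of_isRCLikeNormedField]; exact ENat.LEInfty.out)).eq e e'

/-- Evaluation at a point as a homomorphism of additive groups. -/
def evalQHom (p : U) : ℍ[SmoothFn U] →+ ℍ[ℝ] where
  toFun := evalQ p
  map_zero' := rfl
  map_add' _ _ := rfl

theorem evalQ_mul (p : U) (a b : ℍ[SmoothFn U]) : evalQ p (a * b) = evalQ p a * evalQ p b := by
  ext
  · exact (congrFun (congrArg Subtype.val (Quaternion.re_mul (a := a) (b := b))) p).trans
      (Quaternion.re_mul (a := evalQ p a) (b := evalQ p b)).symm
  · exact (congrFun (congrArg Subtype.val (Quaternion.imI_mul (a := a) (b := b))) p).trans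
      (Quaternion.imI_mul (a := evalQ p a) (b := evalQ p b)).symm
  · exact (congrFun (congrArg Subtype.val (Quaternion.imJ_mul (a := a) (b := b))) p).trans
      (Quaternion.imJ_mul (a := evalQ p a) (b := evalQ p b)).symm
  · exact (congrFun (congrArg Subtype.val (Quaternion.imK_mul (a := a) (b := b))) p).trans
      (Quaternion.imK_mul (a := evalQ p a) (b := evalQ p b)).symm

theorem evalQ_star (p : U) (a : ℍ[SmoothFn U]) : evalQ p (star a) = star (evalQ p a) := by
  ext
  · exact (congrFun (congrArg Subtype.val (Quaternion.re_star (a := a))) p).trans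
      (Quaternion.re_star (a := evalQ p a)).symm
  · exact (congrFun (congrArg Subtype.val (Quaternion.imI_star (a := a))) p).trans
      (Quaternion.imI_star (a := evalQ p a)).symm
  · exact (congrFun (congrArg Subtype.val (Quaternion.imJ_star (a := a))) p).trans
      (Quaternion.imJ_star (a := evalQ p a)).symm
  · exact (congrFun (congrArg Subtype.val (Quaternion.imK_star (a := a))) p).trans
      (Quaternion.imK_star (a := evalQ p a)).symm

theorem evalQ_ext {a b : ℍ[SmoothFn U]} (h : ∀ p, evalQ p a = evalQ p b) : a = b := by
  ext1 <;> apply Subtype.ext <;> funext p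
  · exact congrArg (fun q : ℍ[ℝ] => q.re) (h p)
  · exact congrArg (fun q : ℍ[ℝ] => q.imI) (h p)
  · exact congrArg (fun q : ℍ[ℝ] => q.imJ) (h p)
  · exact congrArg (fun q : ℍ[ℝ] => q.imK) (h p)

end SmoothFn

/-- For `q, x, dx ∈ 𝔥` and `e, y, dy ∈ 𝔪`, the first line of the result is the `𝔥`-part and the
second the `𝔪`-part. -/
theorem commutator_split {R : Type*} [Ring R] [Algebra ℝ R] (c : ℝ) (e q x y dx dy : R) :
    dx + dy + ((c • e + q) * (x + y) - (x + y) * (c • e + q))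
      = (dx + (q * x - x * q)) + c • (e * y - y * e)
        + ((dy + (q * y - y * q)) + c • (e * x - x * e)) := by
  simp only [mul_add, add_mul, smul_mul_assoc, mul_smul_comm, smul_sub, smul_add]
  abel

/-! ### Skew-Hermitian matrices and the structure equations -/

section SkewHermitian

variable {n : ℕ} {A : Type v} [CommRing A] [Algebra ℝ A]

/-- The decomposition `𝔲(n + 1, ℍ) = 𝔥 ⊕ 𝔪`. -/
theorem exists_eq_hMat_add_mMat {M : Matrix (Idx n) (Idx n) ℍ[A]} (hM : M.conjTranspose = -M) :
    ∃ a b c V m mv, star a = -a ∧ star b = -b ∧ V.conjTranspose = -V ∧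
      M = hMat a b c V + mMat m mv := by
  have hs : ∀ i j, star (M j i) = -M i j := by
    intro i j
    exact congrFun (congrFun hM i) j
  have hs' : ∀ i j, M j i = -star (M i j) := by
    intro i j
    rw [hs, neg_neg]
  refine ⟨M (.inl ()) (.inl ()), M (.inr (.inl ())) (.inr (.inl ())),
    fun j => M (.inr (.inl ())) (.inr (.inr j)), fun i j => M (.inr (.inr i)) (.inr (.inr j)),
    M (.inl ()) (.inr (.inl ())), fun j => M (.inl ()) (.inr (.inr j)), hs _ _, hs _ _, ?_, ?_⟩
  · ext1 i j
    exact hs _ _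
  · ext1 i j
    rcases i with ⟨⟩ | ⟨⟩ | i <;> rcases j with ⟨⟩ | ⟨⟩ | j <;> simp [hMat, mMat] <;>
      exact hs' _ _

theorem coe_imPart_of_star {q : ℍ[A]} (hq : star q = -q) : ((imPart q : imH A) : ℍ[A]) = q := by
  have h : q.re = -q.re := by
    have h' := congrArg (fun x : ℍ[A] => x.re) hq
    simpa using h'
  have h0 : q.re = 0 := by
    have h2 : (2 : ℝ) • q.re = 0 := by
      rw [two_smul]
      nth_rewrite 1 [h]
      exact neg_add_cancel _
    have := congrArg (fun x => (2⁻¹ : ℝ) • x) h2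
    simpa using this
  ext <;> simp [imPart, h0]

theorem coe_imPart (q : ℍ[A]) : ((imPart q : imH A) : ℍ[A]) = (1 / 2 : ℝ) • (q - star q) := by
  have h : ∀ a : A, a = (1 / 2 : ℝ) • (a - -a) := by
    intro a
    module
  ext
  · simp [imPart]
  · simpa [imPart] using h q.imI
  · simpa [imPart] using h q.imJ
  · simpa [imPart] using h q.imK

theorem coe_re_quaternion (q : ℍ[A]) : ((q.re : A) : ℍ[A]) = (1 / 2 : ℝ) • (q + star q) := by
  have h : ∀ a : A, a = (1 / 2 : ℝ) • (a + a) := by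
    intro a
    module
  ext
  · simpa using h q.re
  · simp
  · simp
  · simp

section MaurerCartan

variable {ι : Type*} [Fintype ι] [DecidableEq ι] {G : Matrix ι ι ℍ[A]}

theorem dMat_one (D : Derivation ℝ A A) : dMat D (1 : Matrix ι ι ℍ[A]) = 0 := by
  have h := dMat_mul D (1 : Matrix ι ι ℍ[A]) 1
  rw [mul_one, mul_one, one_mul] at h
  exact left_eq_add.1 h

theorem dMat_conjTranspose_mul (hG : G.conjTranspose * G = 1) (D : Derivation ℝ A A) :
    dMat D G.conjTranspose * G = -(G.conjTranspose * dMat D G) := by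
  have h := dMat_mul D G.conjTranspose G
  rw [hG, dMat_one] at h
  exact eq_neg_of_add_eq_zero_left h.symm

theorem conjTranspose_maurerCartan (hG : G.conjTranspose * G = 1) (D : Derivation ℝ A A) :
    (G.conjTranspose * dMat D G).conjTranspose = -(G.conjTranspose * dMat D G) := by
  rw [← dMat_conjTranspose_mul hG, Matrix.conjTranspose_mul,
    Matrix.conjTranspose_conjTranspose, dMat_conjTranspose]

/-- The Maurer-Cartan equation. -/
theorem maurerCartan (hG : G.conjTranspose * G = 1) (hG' : G * G.conjTranspose = 1)
    {D E : Derivation ℝ A A} (hDE : ∀ a, D (E a) = E (D a)) :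
    dMat D (G.conjTranspose * dMat E G) = dMat E (G.conjTranspose * dMat D G)
      + (G.conjTranspose * dMat E G * (G.conjTranspose * dMat D G)
        - G.conjTranspose * dMat D G * (G.conjTranspose * dMat E G)) := by
  have h : ∀ D E : Derivation ℝ A A, dMat D G.conjTranspose * dMat E G
        = -(G.conjTranspose * dMat D G * (G.conjTranspose * dMat E G)) := by
    intro D E
    rw [← neg_mul, ← dMat_conjTranspose_mul hG, mul_assoc, ← mul_assoc G, hG', one_mul]
  rw [dMat_mul, dMat_mul, h, h, dMat_comm hDE]
  abel

end MaurerCartan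

/-- The equations of a parallel frame in operator form. -/
theorem parallel_operatorForm {s : ℝ} (hs : s ≠ 0) {Dt Dx : Derivation ℝ A A} {u : QField n A}
    {F : Matrix (Idx n) (Idx n) ℍ[A]} (hF : F.conjTranspose = -F)
    (hMC : dMat Dt (s⁻¹ • mMat (1 : ℍ[A]) 0 + hPerpMat u) = dMat Dx F
      + ((s⁻¹ • mMat (1 : ℍ[A]) 0 + hPerpMat u) * F - F * (s⁻¹ • mMat (1 : ℍ[A]) 0 + hPerpMat u)))
    {h : QField n A} (hh : h = (s • (2 : ℝ) • (mPerp F).1, -(s • (mPerp F).2))) :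
    ∃ v : QField n A, hamRel Dx u (hPerp F) v ∧ dField Dt u = v + (s * s)⁻¹ • h ∧
      sympRel Dx u h (hPerp F) := by
  obtain ⟨a, b, c, V, m, mv, ha, hb, hV, rfl⟩ := exists_eq_hMat_add_mMat hF
  have hw₁ : ((hPerp (hMat a b c V + mMat m mv)).1 : ℍ[A]) = (1 / 2 : ℝ) • (a - b) := by
    have e : (hPerp (hMat a b c V + mMat m mv)).1 = imPart ((1 / 2 : ℝ) • (a - b)) := by
      simp [hPerp, hMat, mMat]
    rw [e, coe_imPart_of_star]
    rw [Quaternion.star_smul, star_sub, ha, hb]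
    module
  have hw₂ : (hPerp (hMat a b c V + mMat m mv)).2 = c := by
    funext j
    simp [hPerp, hMat, mMat]
  have hh₁ : (h.1 : ℍ[A]) = s • (m - star m) := by
    have e : (mPerp (hMat a b c V + mMat m mv)).1 = imPart m := by
      simp [mPerp, hMat, mMat]
    rw [hh]
    simp only [Submodule.coe_smul, e, coe_imPart]
    module
  have hh₂ : h.2 = -(s • mv) := by
    rw [hh]
    funext j
    simp [mPerp, hMat, mMat]
  generalize hPerp (hMat a b c V + mMat m mv) = w at hw₁ hw₂ ⊢
  clear hh
  have hE : dMat Dt (mMat (1 : ℍ[A]) (0 : Fin (n - 1) → ℍ[A])) = 0 := by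
    ext1 i j
    rcases i with _ | _ | i <;> rcases j with _ | _ | j <;>
      simp [dMat_apply, mMat, dQ_zero, dQ_neg, dQ_one]
  -- The constant `e_x` drops out of the left-hand side, and the right-hand side is sorted into its
  -- `𝔥`- and `𝔪`-parts.
  have hMC' : hPerpMat (dField Dt u)
      = (dMat Dx (hMat a b c V) + (hPerpMat u * hMat a b c V - hMat a b c V * hPerpMat u))
        + s⁻¹ • (mMat 1 0 * mMat m mv - mMat m mv * mMat 1 0)
        + ((dMat Dx (mMat m mv) + (hPerpMat u * mMat m mv - mMat m mv * hPerpMat u))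
          + s⁻¹ • (mMat 1 0 * hMat a b c V - hMat a b c V * mMat 1 0)) := by
    rw [← dMatLin_apply, map_add, map_smul, dMatLin_apply, hE, smul_zero, zero_add, dMatLin_apply,
      dMat_hPerpMat] at hMC
    rw [hMC, ← dMatLin_apply, map_add, dMatLin_apply, dMatLin_apply]
    exact commutator_split _ _ _ _ _ _ _
  rw [covariant_hMat Dx u ha hb hV, commutator_mMat_mMat, covariant_mMat,
    commutator_mMat_hMat ha hb hV] at hMC'
  have ent := fun i j => congrFun (congrFun hMC' i) j
  have e₀₀ := ent (.inl ()) (.inl ())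
  have e₀₁ := ent (.inl ()) (.inr (.inl ()))
  have e₀₂ := fun j => ent (.inl ()) (.inr (.inr j))
  have e₁₁ := ent (.inr (.inl ())) (.inr (.inl ()))
  have e₁₂ := fun j => ent (.inr (.inl ())) (.inr (.inr j))
  have e₂₂ := fun i j => ent (.inr (.inr i)) (.inr (.inr j))
  clear ent hMC' hMC
  simp only [hPerpMat, hMat, mMat, Matrix.add_apply, Matrix.smul_apply, add_zero, zero_add,
    smul_zero, Pi.neg_apply, Matrix.zero_apply, Matrix.sub_apply] at e₀₀ e₀₁ e₀₂ e₁₁ e₁₂ e₂₂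
  have hherm : ∀ x y : Fin (n - 1) → ℍ[A], star (herm x y) = herm y x := by
    intro x y
    simp [herm]
  have hherm₁ : ∀ x y : Fin (n - 1) → ℍ[A], herm (-(s • x)) y = -(s • herm x y) := by
    intro x y
    simp [herm, Finset.smul_sum]
  have hherm₂ : ∀ x y : Fin (n - 1) → ℍ[A], herm x (-(s • y)) = -(s • herm x y) := by
    intro x y
    simp [herm, Finset.smul_sum, Quaternion.star_smul]
  have hs2 : (s * s)⁻¹ * s = s⁻¹ := by field_simp
  have hs3 : ∀ q : ℍ[A], s • s⁻¹ • q = q := fun q => smul_inv_smul₀ hs q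
  -- The scalar `𝔪`-entry, rescaled by `s`, is used with its conjugate: their sum is the real part,
  -- which gives `D r`, and their difference the imaginary part, which gives `w`.
  have f₀₁ := congrArg (fun q => s • q) e₀₁
  have g₀₁ := congrArg star f₀₁
  simp only [smul_add, hs3, smul_zero] at f₀₁
  simp only [smul_add, hs3, smul_zero, star_add, Quaternion.star_smul, star_mul, star_sub,
    star_imH, hherm, ha, hb, ← dQ_star, star_zero, mul_neg, neg_mul] at g₀₁
  have f₀₂ := fun j => congrArg (fun q => s • q) (e₀₂ j)
  simp only [smul_add, hs3, smul_zero] at f₀₂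
  have hp : ((imPart (-((1 / 2 : ℝ) • (a + b))) : imH A) : ℍ[A]) = -((1 / 2 : ℝ) • (a + b)) := by
    apply coe_imPart_of_star
    rw [star_neg, Quaternion.star_smul, star_add, ha, hb]
    module
  have hr : ((-(s • m.re) : A) : ℍ[A]) = -(s • (1 / 2 : ℝ) • (m + star m)) := by
    rw [Quaternion.coe_neg, ← coe_re_quaternion]
    congr 1
    ext <;> simp
  -- With `v = u_t - (s²)⁻¹ h` the flow equation is a tautology, and `𝓗 w = v` is what has to be
  -- checked. The nonlocal variables are read off from the frame: `p` from the mean of the diagonal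
  -- entries of `ω_t`, `r` from the tangential component of `e_t`.
  refine ⟨dField Dt u - (s * s)⁻¹ • h, ⟨imPart (-((1 / 2 : ℝ) • (a + b))), V, hV, ?_, ?_, ?_, ?_⟩,
    by abel, ⟨-(s • m.re), ?_, ?_, ?_⟩⟩
  · rw [hp, hw₁, hw₂]
    simp only [dQ_neg, dQ_smul, dQ_add, opC, opCv, mul_sub, sub_mul, mul_smul_comm, smul_mul_assoc]
    -- The diagonal entries of the left-hand side are `±u_t`, so the sum of the two equations
    -- eliminates `u_t`; their difference is used below for the flow.
    linear_combination (norm := module) (1 / 2 : ℝ) • (e₀₀ + e₁₁)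
  · rw [hw₂]
    ext1 i j
    exact (sub_eq_zero.1 (e₂₂ i j).symm)
  · rw [hp, hw₁, hw₂, Prod.fst_sub, Prod.smul_fst, Submodule.coe_sub, Submodule.coe_smul, hh₁,
      smul_smul, hs2]
    simp only [dQ_sub, dQ_smul, opC, opCv, mul_add, add_mul, mul_neg, neg_mul,
      mul_smul_comm, smul_mul_assoc]
    linear_combination (norm := module) (1 / 2 : ℝ) • (e₀₀ - e₁₁)
  · rw [hp, hw₁, hw₂]
    funext j
    simp only [Prod.snd_sub, Prod.smul_snd, hh₂, smul_neg, smul_smul, hs2, opR, opL, opLm,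
      Pi.add_apply, Pi.sub_apply, Pi.neg_apply, Pi.smul_apply, sub_mul, add_mul, neg_mul,
      smul_mul_assoc, e₁₂ j]
    module
  · rw [← dQ_coe, hr, hh₁, hh₂]
    simp only [dQ_neg, dQ_smul, dQ_add, opA, opAv, hherm₁, hherm₂, mul_sub, sub_mul, mul_smul_comm,
      smul_mul_assoc]
    linear_combination (norm := module) (1 / 2 : ℝ) • (f₀₁ + g₀₁)
  · rw [hr, hh₁, hh₂, hw₁]
    simp only [dQ_smul, dQ_sub, opA, opCv, hherm₁, hherm₂, mul_add, add_mul, mul_neg, neg_mul,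
      mul_smul_comm, smul_mul_assoc]
    linear_combination (norm := module) (1 / 4 : ℝ) • (f₀₁ - g₀₁)
  · rw [hr, hh₁, hh₂, hw₂]
    funext j
    have hj := f₀₂ j
    simp only [opR, opL, Pi.add_apply, Pi.sub_apply, Pi.neg_apply, Pi.smul_apply, dQ_neg, dQ_smul,
      sub_mul, add_mul, neg_mul, mul_neg, mul_smul_comm, smul_mul_assoc]
    linear_combination (norm := module) -hj

end SkewHermitian

/-! ### Unitarity of the frame and the operator form of its flow -/

namespace MovingFrame

variable {n : ℕ} {U : TopologicalSpace.Opens (ℝ × ℝ)} {γ : U → HP n} (g : MovingFrame γ)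

theorem dt_dx_comm (f : SmoothFn U) :
    SmoothFn.dt U (SmoothFn.dx U f) = SmoothFn.dx U (SmoothFn.dt U f) :=
  SmoothFn.dir_comm _ _ f

theorem conjTranspose_mul_mat : g.mat.conjTranspose * g.mat = 1 := by
  ext1 i j
  -- Unitarity is known pointwise, and smooth quaternionic functions are determined by their values.
  apply SmoothFn.evalQ_ext
  intro p
  have hu : star (g.lift p).1 * (g.lift p).1 = 1 := Unitary.coe_star_mul_self (g.lift p)
  have hij := congrFun (congrFun hu i) j
  have he : ∀ f : Idx n → ℍ[SmoothFn U],
      SmoothFn.evalQ p (∑ k, f k) = ∑ k, SmoothFn.evalQ p (f k) :=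
    fun f => map_sum (SmoothFn.evalQHom p) f _
  rw [Matrix.mul_apply] at hij ⊢
  rw [he]
  simp only [Matrix.conjTranspose_apply, SmoothFn.evalQ_mul, SmoothFn.evalQ_star, ← g.lift_eq]
  refine hij.trans ?_
  by_cases h : i = j
  · subst h
    rw [Matrix.one_apply_eq, Matrix.one_apply_eq]
    rfl
  · rw [Matrix.one_apply_ne h, Matrix.one_apply_ne h]
    rfl

theorem mul_conjTranspose_mat : g.mat * g.mat.conjTranspose = 1 := by
  ext1 i j
  apply SmoothFn.evalQ_ext
  intro p
  have hu : (g.lift p).1 * star (g.lift p).1 = 1 := Unitary.coe_mul_star_self (g.lift p)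
  have hij := congrFun (congrFun hu i) j
  have he : ∀ f : Idx n → ℍ[SmoothFn U],
      SmoothFn.evalQ p (∑ k, f k) = ∑ k, SmoothFn.evalQ p (f k) :=
    fun f => map_sum (SmoothFn.evalQHom p) f _
  rw [Matrix.mul_apply] at hij ⊢
  rw [he]
  simp only [Matrix.conjTranspose_apply, SmoothFn.evalQ_mul, SmoothFn.evalQ_star, ← g.lift_eq]
  refine hij.trans ?_
  by_cases h : i = j
  · subst h
    rw [Matrix.one_apply_eq, Matrix.one_apply_eq]
    rfl
  · rw [Matrix.one_apply_ne h, Matrix.one_apply_ne h]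
    rfl

theorem operatorForm_of_isParallel (hg : g.IsParallel) : g.OperatorForm := by
  have hchi : 0 < chi n := by
    unfold chi
    positivity
  have hMC := maurerCartan g.conjTranspose_mul_mat g.mul_conjTranspose_mat (dt_dx_comm (U := U))
  change dMat _ g.formX = dMat _ g.formT + (g.formX * g.formT - g.formT * g.formX) at hMC
  rw [hg] at hMC
  have key := parallel_operatorForm (Real.sqrt_pos.2 hchi).ne'
    (conjTranspose_maurerCartan g.conjTranspose_mul_mat _) hMC (h := g.h) rfl
  -- With `s = √χ` the factor `(s * s)⁻¹` is `χ⁻¹`.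
  rwa [Real.mul_self_sqrt hchi.le] at key

end MovingFrame

theorem mainTheorem1 (n : ℕ) (hn : 1 ≤ n) :
    (∀ (U : TopologicalSpace.Opens (ℝ × ℝ)) (γ : U → HP n) (g : MovingFrame γ),
      g.IsParallel → g.OperatorForm) ∧
    NonlocalOp.IsHamiltonian (opH.{v} n) ∧
    NonlocalOp.IsSymplectic (opJ.{v} n) ∧
    NonlocalOp.Compatible (opH.{v} n) (opJ.{v} n) :=
  ⟨fun _ _ g => g.operatorForm_of_isParallel,
    NonlocalOp.isHamiltonian_of_inverse isSymplectic_inverse_opH, isSymplectic_opJ,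
    compatible_opH_opJ⟩
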